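/- Let $\mathfrak S=(\mathcal P(\mathbb N);\sqcap,\sqcup,c,\mathbf 0,\mathbf 1)$ be the structure whose domain is the set of all subsets of $\mathbb N$ and whose operations are intersection, union, complementation, $\emptyset$ and $\mathbb N$. Let $i(S_1,S_2)=\{2x\mid x\in S_1\}\cup\{2x+1\mid x\in S_2\}$ for $S_1,S_2\subseteq\mathbb N$; let $G$ be any bijection from $\mathbb N$ to the set of finite non-empty subsets of $\mathbb N$; let $e(S)=\{G^{-1}(T)\mid T\subseteq S \text{ finite and non-empty}\}$ for $S\subseteq\mathbb N$; and let $ei(x,y)=e(i(x,y))$. Let $\mathcal{EI}$ be the class of all relations $R\subseteq\mathcal P(\mathbb N)^k$, $k\ge 0$, that have a quantifier-free first-order definition (with equality) over $\mathfrak S$ and are preserved by $ei$, i.e. $(ei(a_1,b_1),\dots,ei(a_k,b_k))\in R$ whenever $(a_1,\dots,a_k),(b_1,\dots,b_k)\in R$. Let $\Gamma$ be a relational structure with domain $\mathcal P(\mathbb N)$ and a finite relational signature, all of whose relations lie in $\mathcal{EI}$. The problem $\mathrm{CSP}(\Gamma)$ is the following: given a finite set $V$ of variables and a finite list of constraints $R(x_1,\dots,x_k)$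 with $R$ a relation symbol of $\Gamma$ and $x_1,\dots,x_k\in V$, decide whether there is a map $s\colon V\to\mathcal P(\mathbb N)$ with $(s(x_1),\dots,s(x_k))\in R^\Gamma$ for every constraint $R(x_1,\dots,x_k)$ in the list. Then $\mathrm{CSP}(\Gamma)$ can be solved in quadratic time: there are a random access machine program and a constant $c$, both depending only on $\Gamma$, such that on every instance the program halts with the correct answer after at most $c\,n^2$ steps, where $n$ is the input size (the number of variables plus the number of words of the input, which lists the number of variables, the number of constraints, and for each constraint its relation symbol and its variables, one word each). Here each arithmetic operation $(+,-,\cdot)$ on words, each comparison of words and each memory access is one step, and all numbers stored by the machine during the run are at most $c\,n^c$ (words of $O(\log n)$ bits). -/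

import Mathlib

open FirstOrder

/-! ### Constraint languages and their satisfaction problems -/

/-- A relational structure with domain `D` and a finite relational signature, whose symbols are
numbered `0, …, numRels - 1`. -/
structure ConstraintLanguage (D : Type) where
  numRels : ℕ
  arity : Fin numRels → ℕ
  rel : (r : Fin numRels) → Set (Fin (arity r) → D)

namespace ConstraintLanguage

variable {D : Type}

/-- An instance of `CSP(Γ)`: variables `0, …, numVars - 1`, and a conjunction (a list) of atomic
formulas `R(x₁, …, xₖ)` with `R` a relation symbol and `x₁, …, xₖ` variables. -/
structure CSPInstance (Γ : ConstraintLanguage D) where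
  numVars : ℕ
  constraints : List ((r : Fin Γ.numRels) × (Fin (Γ.arity r) → Fin numVars))

/-- Some assignment of values to the variables satisfies all constraints. -/
def CSPInstance.Satisfiable {Γ : ConstraintLanguage D} (I : Γ.CSPInstance) : Prop :=
  ∃ s : Fin I.numVars → D, ∀ C ∈ I.constraints, (fun j => s (C.2 j)) ∈ Γ.rel C.1

/-- The input as a sequence of words: the number of variables, the number of constraints, and then
for each constraint the number of its relation symbol followed by its variables. -/
def CSPInstance.encode {Γ : ConstraintLanguage D} (I : Γ.CSPInstance) : List ℕ :=
  I.numVars :: I.constraints.length ::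
    I.constraints.flatMap (fun C => (C.1 : ℕ) :: List.ofFn (fun j => (C.2 j : ℕ)))

/-- The input size: the number of variables plus the number of words of the encoding. -/
def CSPInstance.size {Γ : ConstraintLanguage D} (I : Γ.CSPInstance) : ℕ :=
  I.numVars + I.encode.length

end ConstraintLanguage

/-! ### The machine model: a random access machine with words of bounded size -/

namespace WordRAM

/-- Finitely many of the registers occur in any given program; `mem` is the memory. -/
structure State where
  reg : ℕ → ℕ
  mem : ℕ → ℕ

/-- Programs in structured form. The arguments `d`, `a`, `b` are numbers of registers. -/
inductive Program : Type
  | skip : Program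
  /-- `d := k` -/
  | const (d k : ℕ) : Program
  /-- `d := a + b` -/
  | add (d a b : ℕ) : Program
  /-- `d := a - b` (truncated at `0`) -/
  | sub (d a b : ℕ) : Program
  /-- `d := a * b` -/
  | mul (d a b : ℕ) : Program
  /-- `d := mem[a]` -/
  | load (d a : ℕ) : Program
  /-- `mem[a] := b` -/
  | store (a b : ℕ) : Program
  | seq (p q : Program) : Program
  /-- `if a < b then p else q` -/
  | ifLt (a b : ℕ) (p q : Program) : Program
  /-- `while a < b do p` -/
  | whileLt (a b : ℕ) (p : Program) : Program

def State.setReg (σ : State) (d v : ℕ) : State :=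
  { σ with reg := Function.update σ.reg d v }

def State.setMem (σ : State) (a v : ℕ) : State :=
  { σ with mem := Function.update σ.mem a v }

/-- `Exec B p σ t τ`: on a machine whose words hold the numbers `0, …, B`, the program `p` started
in state `σ` halts after exactly `t` steps in state `τ`. Every instruction and every evaluation of
a test is one step. An instruction whose result does not fit into a word cannot be executed, so
`Exec B p σ t τ` also says that no overflow occurs during the run. -/
inductive Exec (B : ℕ) : Program → State → ℕ → State → Prop
  | skip (σ : State) : Exec B .skip σ 1 σ
  | const (σ : State) (d k : ℕ) (h : k ≤ B) : Exec B (.const d k) σ 1 (σ.setReg d k)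
  | add (σ : State) (d a b : ℕ) (h : σ.reg a + σ.reg b ≤ B) :
      Exec B (.add d a b) σ 1 (σ.setReg d (σ.reg a + σ.reg b))
  | sub (σ : State) (d a b : ℕ) (h : σ.reg a - σ.reg b ≤ B) :
      Exec B (.sub d a b) σ 1 (σ.setReg d (σ.reg a - σ.reg b))
  | mul (σ : State) (d a b : ℕ) (h : σ.reg a * σ.reg b ≤ B) :
      Exec B (.mul d a b) σ 1 (σ.setReg d (σ.reg a * σ.reg b))
  | load (σ : State) (d a : ℕ) (h : σ.mem (σ.reg a) ≤ B) :
      Exec B (.load d a) σ 1 (σ.setReg d (σ.mem (σ.reg a)))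
  | store (σ : State) (a b : ℕ) (h : σ.reg b ≤ B) :
      Exec B (.store a b) σ 1 (σ.setMem (σ.reg a) (σ.reg b))
  | seq {p q : Program} {σ ρ τ : State} {t u : ℕ} (hp : Exec B p σ t ρ) (hq : Exec B q ρ u τ) :
      Exec B (.seq p q) σ (t + u) τ
  | ifTrue {a b : ℕ} {p q : Program} {σ τ : State} {t : ℕ} (h : σ.reg a < σ.reg b)
      (hp : Exec B p σ t τ) : Exec B (.ifLt a b p q) σ (1 + t) τ
  | ifFalse {a b : ℕ} {p q : Program} {σ τ : State} {t : ℕ} (h : ¬ σ.reg a < σ.reg b)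
      (hq : Exec B q σ t τ) : Exec B (.ifLt a b p q) σ (1 + t) τ
  | whileTrue {a b : ℕ} {p : Program} {σ ρ τ : State} {t u : ℕ} (h : σ.reg a < σ.reg b)
      (hp : Exec B p σ t ρ) (hw : Exec B (.whileLt a b p) ρ u τ) :
      Exec B (.whileLt a b p) σ (1 + t + u) τ
  | whileFalse {a b : ℕ} {p : Program} (σ : State) (h : ¬ σ.reg a < σ.reg b) :
      Exec B (.whileLt a b p) σ 1 σ

/-- The initial state: the input stands in the first memory cells, everything else is `0`. -/
def initState (input : List ℕ) : State where
  reg := fun _ => 0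
  mem := fun i => input.getD i 0

/-- The problem `L` on the inputs `α` is decided by one program in time `O(n²)` on machines whose
words have `O(log n)` bits (that is, hold the numbers up to some polynomial in `n`), where `n` is
the size of the input. The input is accepted iff register `0` contains `1` at the end. -/
def DecidableInQuadraticTime {α : Type} (size : α → ℕ) (encode : α → List ℕ) (L : α → Prop) :
    Prop :=
  ∃ (p : Program) (c : ℕ), ∀ x : α, ∃ (t : ℕ) (τ : State),
    Exec (c * size x ^ c) p (initState (encode x)) t τ ∧
      t ≤ c * size x ^ 2 ∧ (τ.reg 0 = 1 ↔ L x)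

end WordRAM

/-- `CSP(Γ)` can be solved in quadratic time. -/
def ConstraintLanguage.CSPSolvableInQuadraticTime {D : Type} (Γ : ConstraintLanguage D) : Prop :=
  WordRAM.DecidableInQuadraticTime (α := Γ.CSPInstance)
    (fun I => I.size) (fun I => I.encode) (fun I => I.Satisfiable)

/-! ### Set constraint languages -/

namespace SetConstraint

/-- The function symbols `⊓`, `⊔`, `c`, `0`, `1`, indexed by their arities. -/
inductive SetFunc : ℕ → Type
  | inter : SetFunc 2
  | union : SetFunc 2
  | compl : SetFunc 1
  | empty : SetFunc 0
  | full : SetFunc 0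

def setLanguage : Language where
  Functions := SetFunc
  Relations := fun _ => Empty

/-- The structure `(𝒫(ℕ); ⊓, ⊔, c, 0, 1)`. -/
instance setStructure : setLanguage.Structure (Set ℕ) where
  funMap := fun {_} f =>
    match f with
    | SetFunc.inter => fun v => v 0 ∩ v 1
    | SetFunc.union => fun v => v 0 ∪ v 1
    | SetFunc.compl => fun v => (v 0)ᶜ
    | SetFunc.empty => fun _ => ∅
    | SetFunc.full => fun _ => Set.univ
  RelMap := fun {_} r => nomatch r

/-- `R` has a quantifier-free first-order definition over `(𝒫(ℕ); ⊓, ⊔, c, 0, 1)`. -/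
def QFDefinable {k : ℕ} (R : Set (Fin k → Set ℕ)) : Prop :=
  ∃ φ : setLanguage.Formula (Fin k), φ.IsQF ∧ ∀ v : Fin k → Set ℕ, v ∈ R ↔ φ.Realize v

/-- The operation `f` of arity `m` preserves the relation `R` of arity `l`. -/
def Preserves {D : Type} {m l : ℕ} (f : (Fin m → D) → D) (R : Set (Fin l → D)) : Prop :=
  ∀ a : Fin m → Fin l → D, (∀ i, a i ∈ R) → (fun j => f (fun i => a i j)) ∈ R

/-- `i(S₁, S₂) = {2x | x ∈ S₁} ∪ {2x + 1 | x ∈ S₂}`. -/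
def iOp (S₁ S₂ : Set ℕ) : Set ℕ :=
  {y | ∃ x ∈ S₁, y = 2 * x} ∪ {y | ∃ x ∈ S₂, y = 2 * x + 1}

/-- The type of finite non-empty sets of natural numbers. -/
abbrev FinNonempty : Type := {T : Finset ℕ // T.Nonempty}

/-- `F(S)`, the set of finite non-empty subsets of `S`. -/
def finiteSubsets (S : Set ℕ) : Set FinNonempty := {T | (T.1 : Set ℕ) ⊆ S}

/-- `e(S) = {G⁻¹(T) | T ∈ F(S)}`, for a bijection `G` between `ℕ` and the finite non-empty subsets
of `ℕ`. -/
def eOp (G : ℕ ≃ FinNonempty) (S : Set ℕ) : Set ℕ :=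
  {n | ∃ T ∈ finiteSubsets S, n = G.symm T}

/-- The binary operation `ei(x, y) = e(i(x, y))`. -/
def eiOp (G : ℕ ≃ FinNonempty) (x : Fin 2 → Set ℕ) : Set ℕ :=
  eOp G (iOp (x 0) (x 1))

/-- The `k`-ary relations in `𝓔𝓘`. -/
def EI (G : ℕ ≃ FinNonempty) (k : ℕ) : Set (Set (Fin k → Set ℕ)) :=
  {R | QFDefinable R ∧ Preserves (eiOp G) R}

end SetConstraint

/-! ### Weakest preconditions for programs without loops -/

namespace WordRAM

/-! A tuple over 𝒫(ℕ) is seen through its `typeSet`, the family of all sets {i | n ∈ v i} for points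
n. Terms are evaluated pointwise, so quantifier-free formulas cannot separate tuples with the same
type set (`mem_iff_typeSet_mem`), and a relation amounts to a finite family F of type sets. On type
sets, `ei` sends A and B to the closure of A ∪ B under non-empty intersections (`typeSet_eiOp`): `i`
forms the union and `e` adds the intersections. Hence, if a non-empty A is a union of members of F,
its meet closure belongs to F (`meetClosure_mem_of_forall`).

An assignment likewise amounts to a non-empty family Y of sets of variables, and a constraint asks
that the restrictions of Y to its arguments form a member of F. For every constraint and every
subset α of its arguments, two kinds of facts are tracked: a variable lies in every y ∈ Y whose
restriction contains α, and no y ∈ Y restricts to α exactly. The Horn rules `SetRule` between such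
facts hold for every solution (`exists_instClosed`). Conversely, let J be a closed set of atoms
without the failure atom. For each α that is not excluded, J yields a set of variables which
restricts to α on its own constraint and to an intersection of non-excluded sets on every other one.
The meet closure of these sets of variables is a solution (`satisfiable_of_instClosed`).

There are boundedly many rows per constraint, and boundedly many rules of bounded length for each
pair of a constraint and a row. With M constraints this gives O(M²) rule slots, and the number of
atoms is O(M) times the number of variables plus one, so the Horn formula has quadratic size.
Forward chaining along occurrence lists is linear in that size. The formula is written out by the
machine in `exists_exec_gen`, solved in `exists_exec_solve`, and the two phases are joined in
`exists_program`. -/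

@[simp] theorem State.reg_setReg (σ : State) (d v i : ℕ) :
    (σ.setReg d v).reg i = if i = d then v else σ.reg i := by
  simp [State.setReg, Function.update_apply]

@[simp] theorem State.mem_setReg (σ : State) (d v : ℕ) : (σ.setReg d v).mem = σ.mem := rfl

@[simp] theorem State.reg_setMem (σ : State) (a v : ℕ) : (σ.setMem a v).reg = σ.reg := rfl

@[simp] theorem State.mem_setMem (σ : State) (a v : ℕ) :
    (σ.setMem a v).mem = Function.update σ.mem a v := rfl

/-- A bound for the running time of a program without loops. -/
def Program.cost : Program → ℕ
  | .seq p q => p.cost + q.cost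
  | .ifLt _ _ p q => 1 + (p.cost + q.cost)
  | _ => 1

/-- `wp B p Q σ`: the program `p`, started in `σ`, halts without overflow in a state with `Q`
(programs with loops are excluded). -/
def wp (B : ℕ) : Program → (State → Prop) → State → Prop
  | .skip, Q, σ => Q σ
  | .const d k, Q, σ => k ≤ B ∧ Q (σ.setReg d k)
  | .add d a b, Q, σ => σ.reg a + σ.reg b ≤ B ∧ Q (σ.setReg d (σ.reg a + σ.reg b))
  | .sub d a b, Q, σ => σ.reg a - σ.reg b ≤ B ∧ Q (σ.setReg d (σ.reg a - σ.reg b))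
  | .mul d a b, Q, σ => σ.reg a * σ.reg b ≤ B ∧ Q (σ.setReg d (σ.reg a * σ.reg b))
  | .load d a, Q, σ => σ.mem (σ.reg a) ≤ B ∧ Q (σ.setReg d (σ.mem (σ.reg a)))
  | .store a b, Q, σ => σ.reg b ≤ B ∧ Q (σ.setMem (σ.reg a) (σ.reg b))
  | .seq p q, Q, σ => wp B p (wp B q Q) σ
  | .ifLt a b p q, Q, σ =>
      (σ.reg a < σ.reg b → wp B p Q σ) ∧ (¬ σ.reg a < σ.reg b → wp B q Q σ)
  | .whileLt _ _ _, _, _ => False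

theorem wp_seq {B : ℕ} {p q : Program} {Q : State → Prop} {σ : State} :
    wp B (.seq p q) Q σ ↔ wp B p (wp B q Q) σ := Iff.rfl

theorem wp_mono {B : ℕ} {p : Program} {Q Q' : State → Prop} (h : ∀ τ, Q τ → Q' τ) {σ : State}
    (hp : wp B p Q σ) : wp B p Q' σ := by
  induction p generalizing Q Q' σ with
  | seq p q ihp ihq => exact ihp (fun τ => ihq h) hp
  | ifLt a b p q ihp ihq => exact ⟨fun c => ihp h (hp.1 c), fun c => ihq h (hp.2 c)⟩
  | whileLt => exact hp
  | skip => exact h _ hp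
  | _ => exact ⟨hp.1, h _ hp.2⟩

/-- Both branches of a test are charged in `cost`, so the time bound does not depend on the state;
the overflow conditions of the single instructions are part of `wp`. -/
theorem exists_exec_of_wp {B : ℕ} {p : Program} {Q : State → Prop} {σ : State}
    (h : wp B p Q σ) : ∃ t τ, Exec B p σ t τ ∧ t ≤ p.cost ∧ Q τ := by
  induction p generalizing Q σ with
  | skip => exact ⟨1, _, .skip σ, le_rfl, h⟩
  | const d k => exact ⟨1, _, .const σ d k h.1, le_rfl, h.2⟩
  | add d a b => exact ⟨1, _, .add σ d a b h.1, le_rfl, h.2⟩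
  | sub d a b => exact ⟨1, _, .sub σ d a b h.1, le_rfl, h.2⟩
  | mul d a b => exact ⟨1, _, .mul σ d a b h.1, le_rfl, h.2⟩
  | load d a => exact ⟨1, _, .load σ d a h.1, le_rfl, h.2⟩
  | store a b => exact ⟨1, _, .store σ a b h.1, le_rfl, h.2⟩
  | seq p q ihp ihq =>
    obtain ⟨t, ρ, h1, h2, h3⟩ := ihp h
    obtain ⟨u, τ, h4, h5, h6⟩ := ihq h3
    exact ⟨t + u, τ, .seq h1 h4, Nat.add_le_add h2 h5, h6⟩
  | ifLt a b p q ihp ihq =>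
    by_cases c : σ.reg a < σ.reg b
    · obtain ⟨t, ρ, h1, h2, h3⟩ := ihp (h.1 c)
      exact ⟨1 + t, ρ, .ifTrue c h1, by simp only [Program.cost]; omega, h3⟩
    · obtain ⟨t, ρ, h1, h2, h3⟩ := ihq (h.2 c)
      exact ⟨1 + t, ρ, .ifFalse c h1, by simp only [Program.cost]; omega, h3⟩
  | whileLt => exact h.elim

/-- A loop with an invariant and a potential that pays for every round. -/
theorem exists_exec_whileLt {B a b : ℕ} {p : Program} (Inv : State → Prop) (Φ : State → ℕ)
    (step : ∀ σ, Inv σ → σ.reg a < σ.reg b →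
      wp B p (fun τ => Inv τ ∧ Φ τ + (p.cost + 1) ≤ Φ σ) σ)
    {σ : State} (h : Inv σ) :
    ∃ t τ, Exec B (.whileLt a b p) σ t τ ∧ t ≤ Φ σ + 1 ∧ Inv τ ∧ ¬ τ.reg a < τ.reg b := by
  -- The potential drops by at least one in every round, so it also yields termination. The extra `+
  -- 1` in the bound pays for the final failing test.
  induction hn : Φ σ using Nat.strong_induction_on generalizing σ with
  | _ n ih =>
    by_cases c : σ.reg a < σ.reg b
    · obtain ⟨t, ρ, h1, h2, h3, h4⟩ := exists_exec_of_wp (step σ h c)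
      obtain ⟨u, τ, h5, h6, h7⟩ := ih (Φ ρ) (by omega) h3 rfl
      exact ⟨1 + t + u, τ, .whileTrue c h1 h5, by omega, h7⟩
    · exact ⟨1, σ, .whileFalse σ c, by omega, h, c⟩

/-! ### Interleaved arrays -/

/-- The memory that holds `inp` below `Z` and, from `Z` on, eight interleaved arrays. -/
def layout (Z : ℕ) (inp : ℕ → ℕ) (A : ℕ → ℕ → ℕ) : ℕ → ℕ :=
  fun a => if a < Z then inp a else A ((a - Z) % 8) ((a - Z) / 8)

/-- The arrays `A` with entry `i` of array `j` replaced by `v`. -/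
def setArr (A : ℕ → ℕ → ℕ) (j i v : ℕ) : ℕ → ℕ → ℕ :=
  fun j' i' => if j' = j ∧ i' = i then v else A j' i'

theorem layout_of_lt {Z : ℕ} {inp : ℕ → ℕ} {A : ℕ → ℕ → ℕ} {a : ℕ} (h : a < Z) :
    layout Z inp A a = inp a := by simp [layout, h]

/-- Interleaving lets all arrays grow without their lengths being known in advance; the array and
the index are recovered as remainder and quotient modulo `8`. -/
theorem layout_apply (Z : ℕ) (inp : ℕ → ℕ) (A : ℕ → ℕ → ℕ) (i j : ℕ) (hj : j < 8) :
    layout Z inp A (i * 8 + (Z + j)) = A j i := by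
  have h1 : ¬ (i * 8 + (Z + j) < Z) := by omega
  have h2 : (i * 8 + (Z + j) - Z) % 8 = j := by omega
  have h3 : (i * 8 + (Z + j) - Z) / 8 = i := by omega
  simp only [layout, h1, h2, h3, if_false]

theorem update_layout (Z : ℕ) (inp : ℕ → ℕ) (A : ℕ → ℕ → ℕ) (i j v : ℕ) (hj : j < 8) :
    Function.update (layout Z inp A) (i * 8 + (Z + j)) v = layout Z inp (setArr A j i v) := by
  funext a
  simp only [Function.update_apply, layout, setArr]
  by_cases h : a = i * 8 + (Z + j)
  · have h1 : ¬ (a < Z) := by omega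
    have h2 : (a - Z) % 8 = j := by omega
    have h3 : (a - Z) / 8 = i := by omega
    rw [if_pos h, if_neg h1, h2, h3]
    simp
  · by_cases h1 : a < Z
    · simp [h, h1]
    · have h2 : ¬ ((a - Z) % 8 = j ∧ (a - Z) / 8 = i) := by omega
      simp only [h, h1, h2, if_false]

/-- The registers of constants used for the access to the arrays: `2` holds the stride, `2 + j`
the address of the first entry of array `j` for `1 ≤ j ≤ 6`. -/
def Bases (Z : ℕ) (ρ : ℕ → ℕ) : Prop :=
  ρ 1 = 1 ∧ ρ 2 = 8 ∧ ∀ j, 1 ≤ j → j ≤ 6 → ρ (2 + j) = Z + j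

/-- `d := A j [i]` -/
def loadArr (j d i : ℕ) : Program :=
  .seq (.mul 20 i 2) (.seq (.add 20 20 (2 + j)) (.load d 20))

/-- `A j [i] := v` -/
def storeArr (j i v : ℕ) : Program :=
  .seq (.mul 20 i 2) (.seq (.add 20 20 (2 + j)) (.store 20 v))

theorem wp_loadArr {B Z j d i : ℕ} {inp : ℕ → ℕ} {A : ℕ → ℕ → ℕ} {σ : State}
    {Q : State → Prop} (hb : Bases Z σ.reg) (hm : σ.mem = layout Z inp A)
    (h1 : 1 ≤ j) (h6 : j ≤ 6) (hB : σ.reg i * 8 + (Z + j) ≤ B) (hA : A j (σ.reg i) ≤ B)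
    (hQ : Q ((σ.setReg 20 (σ.reg i * 8 + (Z + j))).setReg d (A j (σ.reg i)))) :
    wp B (loadArr j d i) Q σ := by
  have hj : ∀ j, 1 ≤ j → j ≤ 6 → σ.reg (2 + j) = Z + j := hb.2.2
  -- The base register `2 + j` is at most `8`, so the scratch register `20` does not overwrite it.
  have hne : (2 + j = 20) ↔ False := by simp; omega
  simp only [loadArr, wp, State.reg_setReg, State.mem_setReg, hb.2.1, if_true, hne, if_false, hm,
    hj j h1 h6, layout_apply _ _ _ _ _ (show j < 8 by omega)]
  refine ⟨by omega, hB, hA, ?_⟩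
  convert hQ using 2
  simp [State.setReg]

theorem wp_storeArr {B Z j i v : ℕ} {inp : ℕ → ℕ} {A : ℕ → ℕ → ℕ} {σ : State}
    {Q : State → Prop} (hb : Bases Z σ.reg) (hm : σ.mem = layout Z inp A)
    (h1 : 1 ≤ j) (h6 : j ≤ 6) (hv : v ≠ 20) (hB : σ.reg i * 8 + (Z + j) ≤ B)
    (hA : σ.reg v ≤ B)
    (hQ : Q ⟨(σ.setReg 20 (σ.reg i * 8 + (Z + j))).reg,
      layout Z inp (setArr A j (σ.reg i) (σ.reg v))⟩) :
    wp B (storeArr j i v) Q σ := by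
  have hj : ∀ j, 1 ≤ j → j ≤ 6 → σ.reg (2 + j) = Z + j := hb.2.2
  have hne : (2 + j = 20) ↔ False := by simp; omega
  simp only [storeArr, wp, State.reg_setReg, hb.2.1, if_true, hne, if_false,
    hj j h1 h6, hv]
  refine ⟨by omega, hB, hA, ?_⟩
  convert hQ using 1
  simp [State.setReg, State.setMem, hm, update_layout _ _ _ _ _ _ (show j < 8 by omega)]

end WordRAM

/-! ### Generating the rules of a Horn formula and their occurrence lists -/

namespace WordRAM

/-- The atoms that occur in rule templates: a true atom, a goal atom, and the cells of a table whose
rows are given absolutely (`none`) or relative to the current constraint, and whose columns are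
the last one (`none`) or given by the arguments of the current constraint. -/
inductive AtomExpr : Type
  | tt : AtomExpr
  | fail : AtomExpr
  | cell (row col : Option ℕ) : AtomExpr

/-- The number of the atom described by an expression, where the rows have `nv + 1` cells,
`D` is the number of the current constraint, `p` the current row. -/
def AtomExpr.val (nv N D p : ℕ) (arg : ℕ → ℕ) : AtomExpr → ℕ
  | .tt => 0
  | .fail => 1
  | .cell row col => 2 + (row.elim p (fun c => c + D * N)) * (nv + 1) + col.elim nv arg

/-- The occurrence lists of the slots `1, …, vals.length` with the atoms `vals`, where rules occupy
`W + 1` consecutive slots. Array `1` holds the atom of a slot, array `2` the preceding slot with the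
same atom, array `3` the first slot of the rule, array `4` the last slot with a given atom. -/
structure Occ (W : ℕ) (vals : List ℕ) (A : ℕ → ℕ → ℕ) : Prop where
  atom : ∀ i (h : i < vals.length), A 1 (i + 1) = vals[i]
  nxt_lt : ∀ i < vals.length, A 2 (i + 1) < i + 1
  nxt_eq : ∀ i < vals.length, A 2 (i + 1) = 0 ∨ A 1 (A 2 (i + 1)) = A 1 (i + 1)
  nxt_gap : ∀ i < vals.length, ∀ s, A 2 (i + 1) < s → s < i + 1 → A 1 s ≠ A 1 (i + 1)
  rul : ∀ i < vals.length, A 3 (i + 1) = 1 + (W + 1) * (i / (W + 1))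
  hd_le : ∀ a, A 4 a ≤ vals.length
  hd_eq : ∀ a, A 4 a = 0 ∨ A 1 (A 4 a) = a
  hd_gap : ∀ a s, A 4 a < s → s ≤ vals.length → A 1 s ≠ a

/-- Occurrence lists have been built, and the arrays for the truth values and for the queue of the
solver are still empty. -/
structure Built (W : ℕ) (vals : List ℕ) (A : ℕ → ℕ → ℕ) : Prop extends Occ W vals A where
  val_eq : ∀ a, A 5 a = 0
  queue_eq : ∀ a, A 6 a = 0

/-- The arrays after the creation of a slot with the atom `x`. -/
def addSlot (A : ℕ → ℕ → ℕ) (s x f : ℕ) : ℕ → ℕ → ℕ :=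
  setArr (setArr (setArr (setArr A 1 s x) 2 s (A 4 x)) 4 x s) 3 s f

/-- The new slot becomes the head of the list of `x` and links to the old head. Slots are numbered
from `1`, so that the initial memory content `0` means the end of a list, and links always lead to
smaller slots. -/
theorem Built.addSlot {W : ℕ} {vals : List ℕ} {A : ℕ → ℕ → ℕ} (h : Built W vals A) (x f : ℕ)
    (hf : f = 1 + (W + 1) * (vals.length / (W + 1))) :
    Built W (vals ++ [x]) (addSlot A (vals.length + 1) x f) := by
  have e1 : ∀ s, WordRAM.addSlot A (vals.length + 1) x f 1 s
      = if s = vals.length + 1 then x else A 1 s := by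
    intro s; simp [WordRAM.addSlot, setArr]
  have e2 : ∀ s, WordRAM.addSlot A (vals.length + 1) x f 2 s
      = if s = vals.length + 1 then A 4 x else A 2 s := by
    intro s; simp [WordRAM.addSlot, setArr]
  have e3 : ∀ s, WordRAM.addSlot A (vals.length + 1) x f 3 s
      = if s = vals.length + 1 then f else A 3 s := by
    intro s; simp [WordRAM.addSlot, setArr]
  have e4 : ∀ s, WordRAM.addSlot A (vals.length + 1) x f 4 s
      = if s = x then vals.length + 1 else A 4 s := by
    intro s; simp [WordRAM.addSlot, setArr]
  have e5 : ∀ s, WordRAM.addSlot A (vals.length + 1) x f 5 s = A 5 s := by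
    intro s; simp [WordRAM.addSlot, setArr]
  have e6 : ∀ s, WordRAM.addSlot A (vals.length + 1) x f 6 s = A 6 s := by
    intro s; simp [WordRAM.addSlot, setArr]
  have hl : (vals ++ [x]).length = vals.length + 1 := by simp
  have hle := h.hd_le
  have hlt := h.nxt_lt
  refine ⟨⟨?_, ?_, ?_, ?_, ?_, ?_, ?_, ?_⟩, ?_, ?_⟩
  · intro i hi
    rw [e1]
    by_cases c : i = vals.length
    · subst c; simp
    · rw [if_neg (by omega), List.getElem_append_left (by omega), h.atom]
  · intro i hi
    rw [hl] at hi
    rw [e2]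
    by_cases c : i = vals.length
    · subst c; have := hle x; simp; omega
    · rw [if_neg (by omega)]; exact hlt i (by omega)
  · intro i hi
    rw [hl] at hi
    rw [e2, e1, e1]
    by_cases c : i = vals.length
    · have h1 := hle x
      have h2 := h.hd_eq x
      subst c
      simp only [if_true]
      rw [if_neg (by omega)]
      exact h2
    · have h1 := hlt i (by omega)
      have h2 := h.nxt_eq i (by omega)
      rw [if_neg (by omega), if_neg (by omega), if_neg (by omega)]
      exact h2
  · intro i hi s
    rw [hl] at hi
    rw [e2, e1, e1]
    by_cases c : i = vals.length
    · subst c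
      simp only [if_true]
      intro h1 h2
      rw [if_neg (by omega)]
      exact h.hd_gap x s h1 (by omega)
    · rw [if_neg (by omega)]
      intro h1 h2
      rw [if_neg (by omega), if_neg (by omega)]
      exact h.nxt_gap i (by omega) s h1 h2
  · intro i hi
    rw [hl] at hi
    rw [e3]
    by_cases c : i = vals.length
    · subst c; simp [hf]
    · rw [if_neg (by omega)]; exact h.rul i (by omega)
  · intro a
    rw [e4, hl]
    split_ifs
    · exact le_rfl
    · have := hle a; omega
  · intro a
    rw [e4]
    split_ifs with c
    · right; rw [e1]; simp [c]
    · have := hle a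
      rw [e1, if_neg (by omega)]
      exact h.hd_eq a
  · intro a s
    rw [e4, hl, e1]
    split_ifs with c c' c'
    · omega
    · omega
    · intro _ _; exact fun h => c h.symm
    · intro h1 h2; exact h.hd_gap a s h1 (by omega)
  · intro a; rw [e5, h.val_eq]
  · intro a; rw [e6, h.queue_eq]

theorem Bases.congr {Z : ℕ} {ρ ρ' : ℕ → ℕ} (h : Bases Z ρ) (e : ∀ i < 14, ρ' i = ρ i) :
    Bases Z ρ' := by
  refine ⟨?_, ?_, fun j h1 h6 => ?_⟩
  · rw [e 1 (by norm_num), h.1]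
  · rw [e 2 (by norm_num), h.2.1]
  · rw [e (2 + j) (by omega), h.2.2 j h1 h6]

/-- Register `19` gets the number of the atom that is described by the expression. -/
def AtomExpr.prog : AtomExpr → Program
  | .tt => .const 19 0
  | .fail => .const 19 1
  | .cell row col =>
    .seq (row.elim (.mul 19 17 9) fun c => .seq (.const 19 c) (.seq (.add 19 19 23) (.mul 19 19 9)))
      (.seq (col.elim (.add 19 19 10) fun i =>
          .seq (.const 21 (i + 1)) (.seq (.add 21 18 21) (.seq (.load 21 21) (.add 19 19 21))))
        (.seq (.const 21 2) (.add 19 21 19)))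

/-- A new slot for the atom in register `19` is created. -/
def emitProg : Program :=
  .seq (.add 14 14 1) (.seq (storeArr 1 14 19) (.seq (loadArr 4 21 19) (.seq (storeArr 2 14 21)
    (.seq (storeArr 4 19 14) (storeArr 3 14 15)))))

/-- The parameters of an input: the number of variables, the number of constraints, the number of
rows per constraint, the size of rule bodies, the end of the input area, and the input. -/
structure Params where
  nv : ℕ
  M : ℕ
  N : ℕ
  W : ℕ
  Z : ℕ
  inp : ℕ → ℕ

/-- The number of atoms. -/
def Params.atoms (P : Params) : ℕ := 2 + P.M * P.N * (P.nv + 1)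

/-- The state during the generation of rules, where the current constraint has number `D` and is
stored at `pos`, and slots for `vals` have been created. -/
structure Generating (P : Params) (D p pos : ℕ) (vals : List ℕ) (σ : State) : Prop where
  bases : Bases P.Z σ.reg
  r9 : σ.reg 9 = P.nv + 1
  r10 : σ.reg 10 = P.nv
  r11 : σ.reg 11 = P.M
  r12 : σ.reg 12 = P.M * P.N
  r13 : σ.reg 13 = P.N
  r14 : σ.reg 14 = vals.length
  r16 : σ.reg 16 = D
  r17 : σ.reg 17 = p
  r18 : σ.reg 18 = pos
  r23 : σ.reg 23 = D * P.N
  mem : ∃ A, σ.mem = layout P.Z P.inp A ∧ Built P.W vals A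

/-- The expression denotes an atom for the constraint `D` at `pos`. -/
def AtomExpr.Valid (P : Params) (D pos : ℕ) (arg : ℕ → ℕ) : AtomExpr → Prop
  | .cell row col => (∀ c ∈ row, c + D * P.N < P.M * P.N) ∧
      ∀ i ∈ col, P.inp (pos + (i + 1)) = arg i ∧ arg i ≤ P.nv ∧ pos + (i + 1) < P.Z
  | _ => True

/-- The constants that occur in the expression are at most `b`. -/
def AtomExpr.Small (b : ℕ) : AtomExpr → Prop
  | .cell row col => (∀ c ∈ row, c ≤ b) ∧ ∀ i ∈ col, i + 1 ≤ b
  | _ => True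

/-- Cells are numbered in mixed radix, with `nv + 1` columns per row, after the two special atoms.
-/
theorem AtomExpr.val_lt {P : Params} {D p pos : ℕ} {arg : ℕ → ℕ} {e : AtomExpr}
    (hp : p < P.M * P.N) (h : e.Valid P D pos arg) : e.val P.nv P.N D p arg < P.atoms := by
  cases e with
  | tt => simp [AtomExpr.val, Params.atoms]
  | fail => simp [AtomExpr.val, Params.atoms]; omega
  | cell row col =>
    have h1 : row.elim p (fun c => c + D * P.N) + 1 ≤ P.M * P.N := by
      cases row with
      | none => exact hp
      | some c => exact h.1 c rfl
    have h2 : col.elim P.nv arg ≤ P.nv := by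
      cases col with
      | none => exact le_rfl
      | some i => exact (h.2 i rfl).2.1
    have h3 := Nat.mul_le_mul_right (P.nv + 1) h1
    rw [Nat.add_mul, one_mul] at h3
    simp only [AtomExpr.val, Params.atoms]
    omega

theorem AtomExpr.wp_prog {P : Params} {D p pos B : ℕ} {arg : ℕ → ℕ} {e : AtomExpr}
    (hp : p < P.M * P.N) (h : e.Valid P D pos arg) (hB : P.atoms + P.Z + P.M * P.N ≤ B)
    (hc : e.Small B)
    {σ : State} (h9 : σ.reg 9 = P.nv + 1) (h10 : σ.reg 10 = P.nv) (h17 : σ.reg 17 = p)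
    (h18 : σ.reg 18 = pos) (h23 : σ.reg 23 = D * P.N) {A : ℕ → ℕ → ℕ}
    (hm : σ.mem = layout P.Z P.inp A) :
    wp B e.prog (fun τ => τ.mem = σ.mem ∧ τ.reg 19 = e.val P.nv P.N D p arg ∧
      ∀ i, i ≠ 19 → i ≠ 21 → τ.reg i = σ.reg i) σ := by
  have hval := AtomExpr.val_lt hp h
  have h2 : 2 ≤ P.atoms := by simp [Params.atoms]
  cases e with
  | tt =>
    refine ⟨by omega, rfl, by simp [AtomExpr.val], fun i h1 h2 => by simp [h1]⟩
  | fail =>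
    refine ⟨by omega, rfl, by simp [AtomExpr.val], fun i h1 h2 => by simp [h1]⟩
  | cell row col =>
    obtain ⟨hc1, hc2⟩ := hc
    -- The treatment of the column is common to both kinds of rows: it starts once register `19`
    -- holds the row number times the row length.
    have key : ∀ (q : ℕ) (τ : State), q < P.M * P.N → τ.mem = σ.mem →
        τ.reg 19 = q * (P.nv + 1) → (∀ i, i ≠ 19 → i ≠ 21 → τ.reg i = σ.reg i) →
        2 + q * (P.nv + 1) + col.elim P.nv arg ≤ B →
        wp B (.seq (col.elim (.add 19 19 10) fun i =>
          .seq (.const 21 (i + 1)) (.seq (.add 21 18 21) (.seq (.load 21 21) (.add 19 19 21))))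
        (.seq (.const 21 2) (.add 19 21 19))) (fun τ => τ.mem = σ.mem ∧
          τ.reg 19 = 2 + q * (P.nv + 1) + col.elim P.nv arg ∧
          ∀ i, i ≠ 19 → i ≠ 21 → τ.reg i = σ.reg i) τ := by
      intro q τ hq hτ h19 hreg hle
      have h10' := hreg 10 (by norm_num) (by norm_num)
      have h18' := hreg 18 (by norm_num) (by norm_num)
      cases col with
      | none =>
        simp only [Option.elim] at hle ⊢
        simp only [wp, State.reg_setReg, State.mem_setReg, h19, h10', h10]
        norm_num
        refine ⟨by omega, by omega, by omega, hτ, by omega, fun i h1 h2 => ?_⟩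
        simp [h1, h2, hreg]
      | some i =>
        obtain ⟨h3, h4, h5⟩ := h.2 i rfl
        have h6 := hc2 i rfl
        have h7 : τ.mem (pos + (i + 1)) = arg i := by rw [hτ, hm, layout_of_lt h5, h3]
        simp only [Option.elim] at hle ⊢
        simp only [wp, State.reg_setReg, State.mem_setReg, h19, h18', h18]
        norm_num
        rw [h7]
        refine ⟨by omega, by omega, by omega, by omega, by omega, by omega, hτ, by omega,
          fun i h1 h2 => ?_⟩
        simp [h1, h2, hreg]
    cases row with
    | none =>
      simp only [AtomExpr.val, Option.elim_none] at hval
      simp only [AtomExpr.prog, AtomExpr.val, Option.elim_none]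
      refine ⟨?_, ?_⟩
      · rw [h17, h9]; omega
      · apply key p _ hp
        · rfl
        · simp [h17, h9]
        · intro i h1 h2; simp [h1]
        · omega
    | some c =>
      have h3 := h.1 c rfl
      have h4 := hc1 c rfl
      simp only [AtomExpr.val, Option.elim_some] at hval
      simp only [AtomExpr.prog, AtomExpr.val, Option.elim_some]
      refine ⟨h4, ?_, ?_, ?_⟩
      · simp [h23]; omega
      · simp [h23, h9]; omega
      · apply key _ _ h3
        · rfl
        · simp [h23, h9]
        · intro i h1 h2; simp [h1]
        · omega

/-- One load and four stores realise `addSlot`; the old head is read from array `4` before it is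
replaced. -/
theorem wp_emitProg {P : Params} {D p pos B x : ℕ} {vals : List ℕ} {σ : State}
    (h : Generating P D p pos vals σ) (hx : σ.reg 19 = x)
    (h15 : σ.reg 15 = 1 + (P.W + 1) * (vals.length / (P.W + 1)))
    (hB : P.Z + 8 * (x + vals.length) + 16 ≤ B) :
    wp B emitProg (fun τ => Generating P D p pos (vals ++ [x]) τ ∧ τ.reg 15 = σ.reg 15) σ := by
  obtain ⟨hb, h9, h10, h11, h12, h13, h14, h16, h17, h18, h23, A, hm, hA⟩ := h
  have hle := hA.hd_le x
  have h15' : σ.reg 15 ≤ 1 + vals.length := by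
    rw [h15]; have := Nat.mul_div_le vals.length (P.W + 1); omega
  have h1 := hb.1
  have bases : ∀ τ : State, (∀ i < 14, τ.reg i = σ.reg i) → Bases P.Z τ.reg :=
    fun τ e => hb.congr e
  refine ⟨by rw [h1, h14]; omega, ?_⟩
  refine wp_storeArr (bases _ ?_) (A := A) (inp := P.inp) ?_ (by norm_num) (by norm_num) (by norm_num) ?_ ?_ ?_
  · intro i hi; simp; omega
  · exact hm
  · simp [h1, h14]; omega
  · simp [hx]; omega
  refine wp_loadArr (bases _ ?_) rfl (by norm_num) (by norm_num) ?_ ?_ ?_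
  · intro i hi
    have e1 : i ≠ 20 := by omega
    have e2 : i ≠ 14 := by omega
    simp [e1, e2]
  · simp [hx]; omega
  · simp [hx, setArr]; omega
  refine wp_storeArr (bases _ ?_) rfl (by norm_num) (by norm_num) (by norm_num) ?_ ?_ ?_
  · intro i hi
    have e1 : i ≠ 20 := by omega
    have e2 : i ≠ 14 := by omega
    have e3 : i ≠ 21 := by omega
    simp [e1, e2, e3]
  · simp [h1, h14]; omega
  · simp [hx, setArr]; omega
  refine wp_storeArr (bases _ ?_) rfl (by norm_num) (by norm_num) (by norm_num) ?_ ?_ ?_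
  · intro i hi
    have e1 : i ≠ 20 := by omega
    have e2 : i ≠ 14 := by omega
    have e3 : i ≠ 21 := by omega
    simp [e1, e2, e3]
  · simp [hx]; omega
  · simp [h1, h14]; omega
  refine wp_storeArr (bases _ ?_) rfl (by norm_num) (by norm_num) (by norm_num) ?_ ?_ ?_
  · intro i hi
    have e1 : i ≠ 20 := by omega
    have e2 : i ≠ 14 := by omega
    have e3 : i ≠ 21 := by omega
    simp [e1, e2, e3]
  · simp [h1, h14]; omega
  · simp; omega
  refine ⟨⟨bases _ ?_, ?_, ?_, ?_, ?_, ?_, ?_, ?_, ?_, ?_, ?_, ?_⟩, ?_⟩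
  · intro i hi
    have e1 : i ≠ 20 := by omega
    have e2 : i ≠ 14 := by omega
    have e3 : i ≠ 21 := by omega
    simp [e1, e2, e3]
  · simp [h9]
  · simp [h10]
  · simp [h11]
  · simp [h12]
  · simp [h13]
  · simp [h1, h14]
  · simp [h16]
  · simp [h17]
  · simp [h18]
  · simp [h23]
  · refine ⟨_, rfl, ?_⟩
    convert hA.addSlot x (σ.reg 15) h15 using 1
    simp [addSlot, h1, h14, hx, setArr]
  · simp

end WordRAM

/-! ### Writing out the rules for all constraints and rows -/

namespace WordRAM

/-- Register `15`, the first slot of the current rule, and the scratch registers are left out of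
`Generating` and may change freely. -/
theorem Generating.congr {P : Params} {D p pos : ℕ} {vals : List ℕ} {σ τ : State}
    (h : Generating P D p pos vals σ) (hm : τ.mem = σ.mem)
    (hr : ∀ i, i ≠ 15 → i ≠ 19 → i ≠ 20 → i ≠ 21 → i ≠ 24 → τ.reg i = σ.reg i) :
    Generating P D p pos vals τ := by
  have e : ∀ i < 15, τ.reg i = σ.reg i := fun i hi => by
    apply hr <;> omega
  refine ⟨h.bases.congr fun i hi => e i (by omega), ?_, ?_, ?_, ?_, ?_, ?_, ?_, ?_, ?_, ?_, ?_⟩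
  · rw [e _ (by norm_num), h.r9]
  · rw [e _ (by norm_num), h.r10]
  · rw [e _ (by norm_num), h.r11]
  · rw [e _ (by norm_num), h.r12]
  · rw [e _ (by norm_num), h.r13]
  · rw [e _ (by norm_num), h.r14]
  · rw [hr 16 (by norm_num) (by norm_num) (by norm_num) (by norm_num) (by norm_num), h.r16]
  · rw [hr 17 (by norm_num) (by norm_num) (by norm_num) (by norm_num) (by norm_num), h.r17]
  · rw [hr 18 (by norm_num) (by norm_num) (by norm_num) (by norm_num) (by norm_num), h.r18]
  · rw [hr 23 (by norm_num) (by norm_num) (by norm_num) (by norm_num) (by norm_num), h.r23]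
  · rw [hm]; exact h.mem

/-- A slot is created for each expression. -/
def emitAll : List AtomExpr → Program
  | [] => .skip
  | e :: es => .seq (.seq e.prog emitProg) (emitAll es)

/-- Here `j` slots of rule number `q` exist already. Since `j + es.length ≤ W + 1`, all new slots
belong to the same rule, and register `15` keeps pointing to its start. -/
theorem wp_emitAll {P : Params} {D p pos B : ℕ} {arg : ℕ → ℕ} (hp : p < P.M * P.N)
    (hB1 : P.atoms + P.Z + P.M * P.N ≤ B) (es : List AtomExpr)
    (hes : ∀ e ∈ es, e.Valid P D pos arg ∧ e.Small B) {vals : List ℕ} {q j : ℕ}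
    (hlen : vals.length = (P.W + 1) * q + j) (hj : j + es.length ≤ P.W + 1)
    (hB2 : P.Z + 8 * (P.atoms + vals.length + es.length) + 16 ≤ B) {σ : State}
    (h : Generating P D p pos vals σ) (h15 : σ.reg 15 = 1 + (P.W + 1) * q) :
    wp B (emitAll es) (Generating P D p pos (vals ++ es.map (AtomExpr.val P.nv P.N D p arg))) σ := by
  induction es generalizing vals σ j with
  | nil => simpa [emitAll, wp] using h
  | cons e es ih =>
    have he := hes e (by simp)
    have hval := AtomExpr.val_lt hp he.1
    obtain ⟨A, hm, -⟩ := h.mem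
    rw [List.length_cons] at hj hB2
    change wp B e.prog (wp B emitProg (wp B (emitAll es) _)) σ
    refine wp_mono ?_ (AtomExpr.wp_prog hp he.1 hB1 he.2 h.r9 h.r10 h.r17 h.r18 h.r23 hm)
    rintro τ ⟨h1, h2, h3⟩
    have h15' : τ.reg 15 = 1 + (P.W + 1) * q := by
      rw [h3 15 (by norm_num) (by norm_num), h15]
    have hdiv : vals.length / (P.W + 1) = q := by
      rw [hlen, Nat.mul_add_div (by omega), Nat.div_eq_of_lt (by omega), add_zero]
    refine wp_mono ?_ (wp_emitProg (h.congr h1 fun i _ a _ b _ => h3 i a b) h2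
      (by rw [hdiv, h15']) (by omega))
    rintro τ' ⟨h4, h5⟩
    have := ih (fun e he => hes e (List.mem_cons_of_mem _ he)) (j := j + 1)
      (vals := vals ++ [e.val P.nv P.N D p arg]) (by simp [hlen, add_assoc]) (by omega)
      (by simp; omega) h4 (by rw [h5, h15'])
    simpa using this

/-- The rules given by the blocks of expressions are created. -/
def emitBlocks : List (List AtomExpr) → Program
  | [] => .skip
  | b :: bs => .seq (.seq (emitAll b) (.add 15 14 1)) (emitBlocks bs)

theorem wp_emitBlocks {P : Params} {D p pos B : ℕ} {arg : ℕ → ℕ} (hp : p < P.M * P.N)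
    (hB1 : P.atoms + P.Z + P.M * P.N ≤ B) (bs : List (List AtomExpr))
    (hlen : ∀ b ∈ bs, b.length = P.W + 1)
    (hbs : ∀ b ∈ bs, ∀ e ∈ b, e.Valid P D pos arg ∧ e.Small B) {vals : List ℕ}
    (hdvd : P.W + 1 ∣ vals.length)
    (hB2 : P.Z + 8 * (P.atoms + vals.length + bs.flatten.length) + 16 ≤ B) {σ : State}
    (h : Generating P D p pos vals σ) (h15 : σ.reg 15 = 1 + vals.length) :
    wp B (emitBlocks bs) (fun τ =>
      let vals' := vals ++ bs.flatMap (List.map (AtomExpr.val P.nv P.N D p arg))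
      Generating P D p pos vals' τ ∧ τ.reg 15 = 1 + vals'.length) σ := by
  induction bs generalizing vals σ with
  | nil => simpa [emitBlocks, wp] using ⟨h, h15⟩
  | cons b bs ih =>
    have hb := hlen b (by simp)
    obtain ⟨q, hq⟩ := hdvd
    rw [List.flatten_cons, List.length_append] at hB2
    change wp B (emitAll b) (wp B (.add 15 14 1) (wp B (emitBlocks bs) _)) σ
    refine wp_mono ?_ (wp_emitAll hp hB1 b (hbs b (by simp)) (j := 0) hq (by omega) (by omega) h
      (by rw [h15, hq]))
    intro τ h1
    refine ⟨by rw [h1.r14, h1.bases.1]; simp; omega, ?_⟩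
    have := ih (fun b hb => hlen b (List.mem_cons_of_mem _ hb))
      (fun b hb => hbs b (List.mem_cons_of_mem _ hb))
      (vals := vals ++ b.map (AtomExpr.val P.nv P.N D p arg))
      (by rw [List.length_append, List.length_map, hb, hq]; exact ⟨q + 1, by ring⟩)
      (by rw [List.length_append, List.length_map]; omega) (σ := τ.setReg 15 (τ.reg 14 + τ.reg 1))
      (h1.congr rfl fun i a _ _ _ _ => by simp [a])
      (by rw [State.reg_setReg, if_pos rfl, h1.r14, h1.bases.1]; simp; omega)
    simpa using this

/-- The program whose number is in register `24` is executed. -/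
def dispatch : List Program → Program
  | [] => .skip
  | q :: qs => .ifLt 24 1 q (.seq (.sub 24 24 1) (dispatch qs))

/-- A switch by repeated decrements of register `24`; the number of tests is fixed by the program,
not by the input. -/
theorem wp_dispatch {B i : ℕ} {qs : List Program} {q : Program} {Q : State → Prop} {σ : State}
    (hi : qs[i]? = some q) (h24 : σ.reg 24 = i) (h1 : σ.reg 1 = 1) (hB : i ≤ B)
    (hq : ∀ τ : State, τ.mem = σ.mem → (∀ j, j ≠ 24 → τ.reg j = σ.reg j) → wp B q Q τ) :
    wp B (dispatch qs) Q σ := by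
  induction qs generalizing i σ with
  | nil => simp at hi
  | cons a qs ih =>
    cases i with
    | zero =>
      simp only [List.getElem?_cons_zero, Option.some.injEq] at hi
      subst hi
      exact ⟨fun _ => hq σ rfl fun _ _ => rfl, fun h => absurd h (by omega)⟩
    | succ i =>
      refine ⟨fun h => absurd h (by omega), fun _ => ⟨by omega, ?_⟩⟩
      refine ih (i := i) (by simpa using hi) (by simp [h24, h1]) (by simp [h1]) (by omega) ?_
      intro τ h2 h3
      exact hq τ h2 fun j hj => by rw [h3 j hj]; simp [hj]

/-- The constraints of an input: `sym D` is the symbol of constraint `D`, `arg D i` are its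
arguments, and it is stored at `pos D`. -/
structure Stored (P : Params) (nR : ℕ) (ar : ℕ → ℕ) (sym : ℕ → ℕ) (arg : ℕ → ℕ → ℕ)
    (pos : ℕ → ℕ) : Prop where
  pos_succ : ∀ D < P.M, pos (D + 1) = pos D + (ar (sym D) + 1)
  pos_le : ∀ D ≤ P.M, pos D ≤ P.Z
  sym_lt : ∀ D < P.M, sym D < nR
  inp_sym : ∀ D < P.M, P.inp (pos D) = sym D
  inp_arg : ∀ D < P.M, ∀ i < ar (sym D), P.inp (pos D + (i + 1)) = arg D i
  arg_lt : ∀ D < P.M, ∀ i < ar (sym D), arg D i < P.nv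

/-- Rule templates for each relation symbol, with `W` atoms in each body. -/
structure Templates (nR : ℕ) (ar : ℕ → ℕ) (N W : ℕ) (tpl : ℕ → List (List AtomExpr)) : Prop where
  length_eq : ∀ r < nR, ∀ b ∈ tpl r, b.length = W + 1
  row_lt : ∀ r < nR, ∀ b ∈ tpl r, ∀ row col, AtomExpr.cell row col ∈ b → ∀ c ∈ row, c < N
  col_lt : ∀ r < nR, ∀ b ∈ tpl r, ∀ row col, AtomExpr.cell row col ∈ b → ∀ i ∈ col, i < ar r

/-- The atoms of the rules for constraint `D` and row `p`. -/
def rulesFor (P : Params) (tpl : ℕ → List (List AtomExpr)) (sym : ℕ → ℕ) (arg : ℕ → ℕ → ℕ)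
    (D p : ℕ) : List ℕ :=
  (tpl (sym D)).flatMap (List.map (AtomExpr.val P.nv P.N D p (arg D)))

/-- The atoms of the rules for all constraints before `D` and all rows, and for constraint `D` and
the rows before `p`. -/
def rulesUpTo (P : Params) (tpl : ℕ → List (List AtomExpr)) (sym : ℕ → ℕ) (arg : ℕ → ℕ → ℕ)
    (D p : ℕ) : List ℕ :=
  (List.range D).flatMap (fun d => (List.range (P.M * P.N)).flatMap (rulesFor P tpl sym arg d)) ++
    (List.range p).flatMap (rulesFor P tpl sym arg D)

theorem length_flatMap_range_le {f : ℕ → List ℕ} {n T : ℕ} (h : ∀ d < n, (f d).length ≤ T) :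
    ((List.range n).flatMap f).length ≤ n * T := by
  induction n with
  | zero => simp
  | succ n ih =>
    have h1 := ih fun d hd => h d (by omega)
    have h2 := h n (by omega)
    rw [List.range_succ, List.flatMap_append, List.length_append, Nat.add_mul]
    simp only [List.flatMap_cons, List.flatMap_nil, List.append_nil]
    omega

theorem dvd_length_flatMap_range {f : ℕ → List ℕ} {n w : ℕ} (h : ∀ d < n, w ∣ (f d).length) :
    w ∣ ((List.range n).flatMap f).length := by
  induction n with
  | zero => simp
  | succ n ih =>
    rw [List.range_succ, List.flatMap_append, List.length_append]
    simp only [List.flatMap_cons, List.flatMap_nil, List.append_nil]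
    exact dvd_add (ih fun d hd => h d (by omega)) (h n (by omega))

theorem length_rulesFor {P : Params} {tpl : ℕ → List (List AtomExpr)} {sym : ℕ → ℕ}
    {arg : ℕ → ℕ → ℕ} (D p : ℕ) :
    (rulesFor P tpl sym arg D p).length = (tpl (sym D)).flatten.length := by
  simp [rulesFor, List.length_flatMap, List.length_flatten]

theorem dvd_length_rulesFor {P : Params} {nR : ℕ} {ar : ℕ → ℕ} {tpl : ℕ → List (List AtomExpr)}
    {sym : ℕ → ℕ} {arg : ℕ → ℕ → ℕ} (ht : Templates nR ar P.N P.W tpl) {D : ℕ}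
    (hD : sym D < nR) (p : ℕ) : P.W + 1 ∣ (rulesFor P tpl sym arg D p).length := by
  rw [length_rulesFor, List.length_flatten]
  refine List.dvd_sum fun x hx => ?_
  obtain ⟨b, hb, rfl⟩ := List.mem_map.1 hx
  rw [ht.length_eq _ hD b hb]

/-- For `D = P.M` there is no current constraint and `sym D` is unspecified; `p = 0` makes the
second part of the list empty. -/
theorem dvd_length_rulesUpTo {P : Params} {nR : ℕ} {ar : ℕ → ℕ} {tpl : ℕ → List (List AtomExpr)}
    {sym : ℕ → ℕ} {arg : ℕ → ℕ → ℕ} {pos : ℕ → ℕ} (ht : Templates nR ar P.N P.W tpl)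
    (hs : Stored P nR ar sym arg pos) {D : ℕ} (hD : D ≤ P.M) {p : ℕ} (hp : D = P.M → p = 0) :
    P.W + 1 ∣ (rulesUpTo P tpl sym arg D p).length := by
  rw [rulesUpTo, List.length_append]
  refine dvd_add (dvd_length_flatMap_range fun d hd => dvd_length_flatMap_range fun q _ =>
    dvd_length_rulesFor ht (hs.sym_lt d (by omega)) q) (dvd_length_flatMap_range fun q hq => ?_)
  refine dvd_length_rulesFor ht (hs.sym_lt D ?_) q
  by_contra hc
  have := hp (by omega)
  omega

theorem length_rulesUpTo_le {P : Params} {nR : ℕ} {ar : ℕ → ℕ} {tpl : ℕ → List (List AtomExpr)}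
    {sym : ℕ → ℕ} {arg : ℕ → ℕ → ℕ} {pos : ℕ → ℕ} {T : ℕ}
    (hT : ∀ r < nR, (tpl r).flatten.length ≤ T)
    (hs : Stored P nR ar sym arg pos) {D : ℕ} (hD : D ≤ P.M) {p : ℕ} (hp : D = P.M → p = 0) :
    (rulesUpTo P tpl sym arg D p).length ≤ (D * (P.M * P.N) + p) * T := by
  rw [rulesUpTo, List.length_append, Nat.add_mul, mul_assoc]
  refine Nat.add_le_add (length_flatMap_range_le fun d hd => length_flatMap_range_le fun q _ => ?_)
    (length_flatMap_range_le fun q hq => ?_)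
  · rw [length_rulesFor]
    exact hT _ (hs.sym_lt d (by omega))
  · rw [length_rulesFor]
    refine hT _ (hs.sym_lt D ?_)
    by_contra hc
    have := hp (by omega)
    omega

/-- One round of the generation of rules. -/
def genBody (nR : ℕ) (ar : ℕ → ℕ) (tpl : ℕ → List (List AtomExpr)) : Program :=
  .ifLt 17 12
    (.seq (.load 24 18) (.seq (dispatch ((List.range nR).map fun r => emitBlocks (tpl r)))
      (.add 17 17 1)))
    (.seq (.load 24 18) (.seq (dispatch ((List.range nR).map fun r => .const 21 (ar r + 1)))
      (.seq (.add 18 18 21) (.seq (.const 17 0) (.seq (.add 16 16 1) (.add 23 23 13))))))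

/-- The nested loop over constraints and rows is flattened into one loop with a loop-free body: a
round either writes the rules for row `p` or, past the last row, moves to the next constraint. -/
theorem wp_genBody {P : Params} {nR : ℕ} {ar : ℕ → ℕ} {tpl : ℕ → List (List AtomExpr)}
    {sym : ℕ → ℕ} {arg : ℕ → ℕ → ℕ} {pos : ℕ → ℕ} {T B : ℕ} (ht : Templates nR ar P.N P.W tpl)
    (hs : Stored P nR ar sym arg pos) (hT : ∀ r < nR, (tpl r).flatten.length ≤ T)
    (hsmall : ∀ r < nR, ∀ b ∈ tpl r, ∀ e ∈ b, e.Small B) (hB0 : ∀ r < nR, r ≤ B ∧ ar r + 1 ≤ B)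
    (hB1 : P.atoms + P.Z + P.M * P.N ≤ B)
    (hB2 : P.Z + 8 * (P.atoms + P.M * (P.M * P.N) * T) + 16 ≤ B)
    {D p : ℕ} (hD : D < P.M) (hp : p ≤ P.M * P.N) {σ : State}
    (h : Generating P D p (pos D) (rulesUpTo P tpl sym arg D p) σ)
    (h15 : σ.reg 15 = 1 + (rulesUpTo P tpl sym arg D p).length) :
    wp B (genBody nR ar tpl) (fun τ => ∃ D' p', D' ≤ P.M ∧ p' ≤ P.M * P.N ∧ (D' = P.M → p' = 0) ∧
      Generating P D' p' (pos D') (rulesUpTo P tpl sym arg D' p') τ ∧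
      τ.reg 15 = 1 + (rulesUpTo P tpl sym arg D' p').length ∧
      (D' = D ∧ p' = p + 1 ∨ D' = D + 1 ∧ p' = 0 ∧ p = P.M * P.N)) σ := by
  obtain ⟨A, hm, hA⟩ := h.mem
  have hsym := hs.sym_lt D hD
  have hpos := hs.pos_le (D + 1) hD
  have hsucc := hs.pos_succ D hD
  have hmem : σ.mem (σ.reg 18) = sym D := by
    rw [hm, h.r18, layout_of_lt (by omega), hs.inp_sym D hD]
  have hD1 := Nat.mul_le_mul_right (P.M * P.N) (show D + 1 ≤ P.M from hD)
  have hD2 := Nat.mul_le_mul_right P.N (show D + 1 ≤ P.M from hD)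
  rw [Nat.add_mul, one_mul] at hD1 hD2
  refine ⟨fun hlt => ?_, fun hlt => ?_⟩
  · rw [h.r17, h.r12] at hlt
    refine ⟨by rw [hmem]; exact (hB0 _ hsym).1, ?_⟩
    rw [hmem]
    refine wp_dispatch (i := sym D) (q := emitBlocks (tpl (sym D))) (by simp [hsym]) (by simp)
      (by simpa using h.bases.1) (hB0 _ hsym).1 ?_
    intro τ h1 h2
    have hτ : Generating P D p (pos D) (rulesUpTo P tpl sym arg D p) τ :=
      h.congr h1 fun i _ _ _ _ a => by rw [h2 i a]; simp [a]
    have hlen := length_rulesUpTo_le hT hs hD.le (p := p) (by omega) (tpl := tpl)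
    have hT' := hT _ hsym
    have hle := Nat.mul_le_mul_right T
      (show D * (P.M * P.N) + p + 1 ≤ P.M * (P.M * P.N) by omega)
    rw [Nat.add_mul, one_mul] at hle
    refine wp_mono ?_ (wp_emitBlocks (arg := arg D) hlt hB1 (tpl (sym D)) (ht.length_eq _ hsym) ?_
      (dvd_length_rulesUpTo ht hs hD.le (by omega)) (by omega) hτ
      (by rw [h2 15 (by norm_num)]; simpa using h15))
    · rintro τ' ⟨h3, h4⟩
      have hnew : rulesUpTo P tpl sym arg D p ++
          (tpl (sym D)).flatMap (List.map (AtomExpr.val P.nv P.N D p (arg D)))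
          = rulesUpTo P tpl sym arg D (p + 1) := by
        simp [rulesUpTo, rulesFor, List.range_succ, List.flatMap_append]
      rw [hnew] at h3 h4
      refine ⟨by rw [h3.r17, h3.bases.1]; omega, D, p + 1, hD.le, hlt, by omega,
        ⟨h3.bases.congr ?_, ?_, ?_, ?_, ?_, ?_, ?_, ?_, ?_, ?_, ?_, ?_⟩, ?_, .inl ⟨rfl, rfl⟩⟩
      · intro i hi
        rw [State.reg_setReg, if_neg (by omega)]
      · simpa using h3.r9
      · simpa using h3.r10
      · simpa using h3.r11
      · simpa using h3.r12
      · simpa using h3.r13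
      · simpa using h3.r14
      · simpa using h3.r16
      · simp [h3.r17, h3.bases.1]
      · simpa using h3.r18
      · simpa using h3.r23
      · exact h3.mem
      · simpa using h4
    · intro b hb e he
      refine ⟨?_, hsmall _ hsym b hb e he⟩
      cases e with
      | tt => trivial
      | fail => trivial
      | cell row col =>
        refine ⟨fun c hc => ?_, fun i hi => ?_⟩
        · have := ht.row_lt _ hsym b hb row col he c hc
          omega
        · have := ht.col_lt _ hsym b hb row col he i hi
          refine ⟨hs.inp_arg D hD i this, (hs.arg_lt D hD i this).le, by omega⟩
  · rw [h.r17, h.r12] at hlt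
    have hpe : p = P.M * P.N := by omega
    refine ⟨by rw [hmem]; exact (hB0 _ hsym).1, ?_⟩
    rw [hmem]
    refine wp_dispatch (i := sym D) (q := .const 21 (ar (sym D) + 1)) (by simp [hsym]) (by simp)
      (by simpa using h.bases.1) (hB0 _ hsym).1 ?_
    intro τ h1 h2
    have hτ : Generating P D p (pos D) (rulesUpTo P tpl sym arg D p) τ :=
      h.congr h1 fun i _ _ _ _ a => by rw [h2 i a]; simp [a]
    have h15' : τ.reg 15 = σ.reg 15 := by rw [h2 15 (by norm_num)]; simp
    -- Moving to the next constraint writes nothing: all rows of constraint `D` are done.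
    have hnew : rulesUpTo P tpl sym arg (D + 1) 0 = rulesUpTo P tpl sym arg D p := by
      simp [rulesUpTo, List.range_succ, List.flatMap_append, hpe]
    refine ⟨(hB0 _ hsym).2, ?_, by omega, ?_, ?_, D + 1, 0, hD, by omega, by omega, ?_, ?_,
      .inr ⟨rfl, rfl, hpe⟩⟩
    · simp [hτ.r18]; omega
    · simp [hτ.r16, hτ.bases.1]
      -- The constraint counter must fit into a word. If `N = 0`, the product gives no bound, but
      -- every constraint occupies at least one word of the input area.
      have h3 : P.M ≤ P.Z + P.M * P.N := by
        by_cases hN : P.N = 0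
        · have hmono : ∀ d ≤ P.M, d ≤ pos d := by
            intro d
            induction d with
            | zero => intro _; omega
            | succ d ih =>
              intro hd
              have h3 := ih (by omega)
              have h4 := hs.pos_succ d (by omega)
              omega
          have h3 := hmono P.M le_rfl
          have h4 := hs.pos_le P.M le_rfl
          omega
        · have := Nat.le_mul_of_pos_right P.M (show 0 < P.N by omega)
          omega
      omega
    · simp [hτ.r23, hτ.r13]
      omega
    · rw [hnew]
      refine ⟨hτ.bases.congr ?_, ?_, ?_, ?_, ?_, ?_, ?_, ?_, ?_, ?_, ?_, ?_⟩
      · intro i hi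
        simp only [State.reg_setReg]
        rw [if_neg (by omega), if_neg (by omega), if_neg (by omega), if_neg (by omega),
          if_neg (by omega)]
      · simpa using hτ.r9
      · simpa using hτ.r10
      · simpa using hτ.r11
      · simpa using hτ.r12
      · simpa using hτ.r13
      · simpa using hτ.r14
      · simp [hτ.r16, hτ.bases.1]
      · simp
      · simp [hτ.r18, hsucc]
      · simp [hτ.r23, hτ.r13, Nat.add_mul]
      · exact hτ.mem
    · rw [hnew]
      simp [h15', h15]

theorem exists_exec_gen {P : Params} {nR : ℕ} {ar : ℕ → ℕ} {tpl : ℕ → List (List AtomExpr)}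
    {sym : ℕ → ℕ} {arg : ℕ → ℕ → ℕ} {pos : ℕ → ℕ} {T B : ℕ} (ht : Templates nR ar P.N P.W tpl)
    (hs : Stored P nR ar sym arg pos) (hT : ∀ r < nR, (tpl r).flatten.length ≤ T)
    (hsmall : ∀ r < nR, ∀ b ∈ tpl r, ∀ e ∈ b, e.Small B) (hB0 : ∀ r < nR, r ≤ B ∧ ar r + 1 ≤ B)
    (hB1 : P.atoms + P.Z + P.M * P.N ≤ B)
    (hB2 : P.Z + 8 * (P.atoms + P.M * (P.M * P.N) * T) + 16 ≤ B)
    {σ : State} (h : Generating P 0 0 (pos 0) [] σ) (h15 : σ.reg 15 = 1) :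
    ∃ t τ, Exec B (.whileLt 16 11 (genBody nR ar tpl)) σ t τ ∧
      t ≤ ((genBody nR ar tpl).cost + 1) * (P.M * (P.M * P.N + 1)) + 1 ∧
      Generating P P.M 0 (pos P.M) (rulesUpTo P tpl sym arg P.M 0) τ := by
  have h0 : rulesUpTo P tpl sym arg 0 0 = [] := by simp [rulesUpTo]
  let Inv : State → Prop := fun σ => ∃ D p, D ≤ P.M ∧ p ≤ P.M * P.N ∧ (D = P.M → p = 0) ∧
    Generating P D p (pos D) (rulesUpTo P tpl sym arg D p) σ ∧
    σ.reg 15 = 1 + (rulesUpTo P tpl sym arg D p).length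
  -- The second factor counts the rounds left: each remaining constraint takes one round per row and
  -- one for the transition.
  let Φ : State → ℕ := fun σ => ((genBody nR ar tpl).cost + 1) *
    ((P.M - σ.reg 16) * (P.M * P.N + 1) - σ.reg 17)
  have step : ∀ σ, Inv σ → σ.reg 16 < σ.reg 11 → wp B (genBody nR ar tpl)
      (fun τ => Inv τ ∧ Φ τ + ((genBody nR ar tpl).cost + 1) ≤ Φ σ) σ := by
    rintro σ ⟨D, p, h3, h4, h5, h6, h7⟩ hlt
    rw [h6.r16, h6.r11] at hlt
    refine wp_mono ?_ (wp_genBody ht hs hT hsmall hB0 hB1 hB2 hlt h4 h6 h7)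
    rintro τ ⟨D', p', g1, g2, g3, g4, g5, g6⟩
    refine ⟨⟨D', p', g1, g2, g3, g4, g5⟩, ?_⟩
    simp only [Φ]
    rw [h6.r16, h6.r17, g4.r16, g4.r17]
    have key : (P.M - D') * (P.M * P.N + 1) - p' + 1 ≤ (P.M - D) * (P.M * P.N + 1) - p := by
      obtain ⟨k, hk⟩ : ∃ k, P.M = D + (k + 1) := ⟨P.M - D - 1, by omega⟩
      have e1 : P.M - D = k + 1 := by omega
      have e2 : P.M - (D + 1) = k := by omega
      rcases g6 with ⟨rfl, rfl⟩ | ⟨rfl, rfl, rfl⟩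
      · rw [e1, Nat.add_mul k, one_mul]; omega
      · rw [e1, e2, Nat.add_mul k, one_mul]; omega
    have := Nat.mul_le_mul_left ((genBody nR ar tpl).cost + 1) key
    rw [Nat.mul_add, mul_one] at this
    exact this
  obtain ⟨t, τ, h1, h2, ⟨D, p, h3, h4, h5, h6, h7⟩, h8⟩ := exists_exec_whileLt Inv Φ step (σ := σ)
    ⟨0, 0, by omega, by omega, fun _ => rfl, by rw [h0]; exact h, by simp [h0, h15]⟩
  have hDM : D = P.M := by
    rw [h6.r16, h6.r11] at h8
    omega
  have hp := h5 hDM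
  subst hDM hp
  refine ⟨t, τ, h1, ?_, h6⟩
  simpa [Φ, h.r16, h.r17] using h2

end WordRAM

/-! ### Solving a Horn formula in linear time -/

namespace WordRAM

/-- The set `J` of atoms contains `0` and is closed under the rules that are listed in `vals`, where
each rule is given by `W` atoms for the body and one atom for the head. -/
def RuleClosed (W : ℕ) (vals : List ℕ) (J : Set ℕ) : Prop :=
  0 ∈ J ∧ ∀ r, (W + 1) * (r + 1) ≤ vals.length →
    (∀ j < W, vals.getD ((W + 1) * r + j) 0 ∈ J) → vals.getD ((W + 1) * r + W) 0 ∈ J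

theorem Occ.atom_getD {W : ℕ} {vals : List ℕ} {A : ℕ → ℕ → ℕ} (h : Occ W vals A) {i : ℕ}
    (hi : i < vals.length) : A 1 (i + 1) = vals.getD i 0 := by
  rw [h.atom i hi, List.getD_eq_getElem _ _ hi]

theorem Occ.congr {W : ℕ} {vals : List ℕ} {A A' : ℕ → ℕ → ℕ} (h : Occ W vals A)
    (e : ∀ j < 5, A' j = A j) : Occ W vals A' := by
  have e1 := e 1 (by norm_num)
  have e2 := e 2 (by norm_num)
  have e3 := e 3 (by norm_num)
  have e4 := e 4 (by norm_num)
  obtain ⟨h1, h2, h3, h4, h5, h6, h7, h8⟩ := h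
  constructor <;> simpa only [e1, e2, e3, e4]

/-- The slot `s` has been processed when the atoms of the queue `Q` before `qh` have been processed
completely, and the occurrence list of the next atom has been processed down to `cur`. -/
def Processed (vals Q : List ℕ) (qh cur s : ℕ) : Prop :=
  vals.getD (s - 1) 0 ∈ Q.take qh ∨
    (qh < Q.length ∧ Q.getD qh 0 = vals.getD (s - 1) 0 ∧ cur < s)

/-- The invariant of the solver: `Q` is the queue of atoms found to be true, the atoms before `qh`
have been processed, and `cur` is the current position in the occurrence list of the next one. -/
structure SolverInv (W n : ℕ) (vals Q : List ℕ) (qh cur : ℕ) : Prop where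
  nodup : Q.Nodup
  lt : ∀ a ∈ Q, a < n
  zero_mem : 0 ∈ Q
  qh_le : qh ≤ Q.length
  cur_le : cur ≤ vals.length
  cur_eq : qh < Q.length → cur = 0 ∨ vals.getD (cur - 1) 0 = Q.getD qh 0
  sound : ∀ J, RuleClosed W vals J → ∀ a ∈ Q, a ∈ J
  complete : ∀ r, (W + 1) * (r + 1) ≤ vals.length →
    (∀ j < W, Processed vals Q qh cur ((W + 1) * r + j + 1)) →
    vals.getD ((W + 1) * r + W) 0 ∈ Q

theorem SolverInv.length_le {W n : ℕ} {vals Q : List ℕ} {qh cur : ℕ}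
    (h : SolverInv W n vals Q qh cur) : Q.length ≤ n := by
  have h1 : Q.toFinset ⊆ Finset.range n := fun a ha => by
    simpa using h.lt a (by simpa using ha)
  have h2 := Finset.card_le_card h1
  rwa [List.toFinset_card_of_nodup h.nodup, Finset.card_range] at h2

open Classical in
/-- The number of slots that have not been processed. -/
noncomputable def unprocessed (vals Q : List ℕ) (qh cur : ℕ) : ℕ :=
  ((Finset.Icc 1 vals.length).filter fun s => ¬ Processed vals Q qh cur s).card

theorem mem_of_processed {vals Q : List ℕ} {qh cur s : ℕ} (h : Processed vals Q qh cur s) :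
    vals.getD (s - 1) 0 ∈ Q := by
  rcases h with h | ⟨h1, h2, -⟩
  · exact List.mem_of_mem_take h
  · rw [← h2, List.getD_eq_getElem _ _ h1]
    exact List.getElem_mem h1

open Classical in
/-- The queue after the inspection of rule `r`. -/
noncomputable def fire (W : ℕ) (vals Q : List ℕ) (r : ℕ) : List ℕ :=
  if (∀ j < W, vals.getD ((W + 1) * r + j) 0 ∈ Q) ∧ vals.getD ((W + 1) * r + W) 0 ∉ Q then
    Q ++ [vals.getD ((W + 1) * r + W) 0] else Q

theorem fire_eq_append (W : ℕ) (vals Q : List ℕ) (r : ℕ) : ∃ l, fire W vals Q r = Q ++ l := by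
  unfold fire
  split_ifs
  · exact ⟨_, rfl⟩
  · exact ⟨[], by simp⟩

/-- Only the queue entries up to `qh` matter, and these are not affected by appending at the end. -/
theorem processed_append {vals Q l : List ℕ} {qh cur s : ℕ} (hq : qh < Q.length) :
    Processed vals (Q ++ l) qh cur s ↔ Processed vals Q qh cur s := by
  unfold Processed
  rw [List.take_append_of_le_length hq.le, List.getD_append _ _ _ _ hq, List.length_append]
  have : qh < Q.length + l.length := by omega
  simp [hq, this]

-- Following the link of slot `cur` makes exactly this slot processed, since no slot strictly
-- between the link and `cur` carries the same atom. Hence completeness can only be endangered for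
-- the rule containing `cur`, and this rule is inspected by `fire`. Each slot is paid for once.
open Classical in
theorem SolverInv.slot {W n : ℕ} {vals Q : List ℕ} {qh cur : ℕ} {A : ℕ → ℕ → ℕ}
    (h : SolverInv W n vals Q qh cur) (hA : Occ W vals A) (hv : ∀ x ∈ vals, x < n)
    (hd : W + 1 ∣ vals.length) (hq : qh < Q.length) (hc : 0 < cur) :
    SolverInv W n vals (fire W vals Q ((cur - 1) / (W + 1))) qh (A 2 cur) ∧
      unprocessed vals (fire W vals Q ((cur - 1) / (W + 1))) qh (A 2 cur) + 1
        ≤ unprocessed vals Q qh cur := by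
  set r := (cur - 1) / (W + 1) with hr
  obtain ⟨l, hl⟩ := fire_eq_append W vals Q r
  obtain ⟨i, rfl⟩ : ∃ i, cur = i + 1 := ⟨cur - 1, by omega⟩
  have hi : i < vals.length := h.cur_le
  have hcur : vals.getD i 0 = Q.getD qh 0 := by
    rcases h.cur_eq hq with h1 | h1
    · omega
    · exact h1
  have hsub : ∀ a ∈ Q, a ∈ fire W vals Q r := fun a ha => by rw [hl]; simp [ha]
  have hproc : ∀ s, 1 ≤ s → s ≤ vals.length → s ≠ i + 1 →
      (Processed vals (fire W vals Q r) qh (A 2 (i + 1)) s → Processed vals Q qh (i + 1) s) := by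
    intro s h1 h2 h3
    rw [hl, processed_append hq]
    rintro (h4 | ⟨h4, h5, h6⟩)
    · exact .inl h4
    · refine .inr ⟨h4, h5, ?_⟩
      by_contra h7
      obtain ⟨k, rfl⟩ : ∃ k, s = k + 1 := ⟨s - 1, by omega⟩
      have h8 := hA.nxt_gap i hi (k + 1) h6 (by omega)
      rw [hA.atom_getD (by omega), hA.atom_getD hi, hcur] at h8
      exact h8 h5.symm
  have hproc' : ∀ s, Processed vals Q qh (i + 1) s →
      Processed vals (fire W vals Q r) qh (A 2 (i + 1)) s := by
    intro s
    rw [hl, processed_append hq]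
    rintro (h4 | ⟨h4, h5, h6⟩)
    · exact .inl h4
    · exact .inr ⟨h4, h5, (hA.nxt_lt i hi).trans h6⟩
  -- The queue has no repetitions, so the atom at position `qh` does not occur before it.
  have hnot : ¬ Processed vals Q qh (i + 1) (i + 1) := by
    rintro (h4 | ⟨h4, h5, h6⟩)
    · rw [Nat.add_sub_cancel, hcur, List.getD_eq_getElem _ _ hq] at h4
      obtain ⟨k, hk, hk'⟩ := List.getElem_of_mem h4
      rw [List.length_take] at hk
      rw [List.getElem_take] at hk'
      have := (h.nodup.getElem_inj_iff).1 hk'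
      omega
    · omega
  have hnew : Processed vals (fire W vals Q r) qh (A 2 (i + 1)) (i + 1) := by
    rw [hl, processed_append hq]
    exact .inr ⟨hq, hcur.symm, hA.nxt_lt i hi⟩
  -- Divisibility by `W + 1` means that the last rule is complete, so the head of the rule of this
  -- slot is present.
  obtain ⟨R, hR⟩ := hd
  have hrle : (W + 1) * (r + 1) ≤ vals.length := by
    rw [hR]
    refine Nat.mul_le_mul_left _ ?_
    rw [hr, Nat.succ_le_iff, Nat.div_lt_iff_lt_mul (by omega), mul_comm, ← hR]
    simpa using hi
  have hhead : (W + 1) * r + W < vals.length := by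
    rw [Nat.mul_add, mul_one] at hrle; omega
  refine ⟨⟨?_, ?_, hsub 0 h.zero_mem, ?_, ?_, ?_, ?_, ?_⟩, ?_⟩
  · unfold fire
    split_ifs with hf
    · rw [List.nodup_append]
      refine ⟨h.nodup, by simp, ?_⟩
      intro a ha b hb hab
      rw [List.mem_singleton] at hb
      exact hf.2 (by rw [← hb, ← hab]; exact ha)
    · exact h.nodup
  · unfold fire
    split_ifs with hf
    · intro a ha
      rcases List.mem_append.1 ha with ha | ha
      · exact h.lt a ha
      · rw [List.mem_singleton] at ha
        rw [ha, List.getD_eq_getElem _ _ hhead]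
        exact hv _ (List.getElem_mem _)
    · exact h.lt
  · rw [hl, List.length_append]; omega
  · have := hA.nxt_lt i hi; omega
  · intro _
    have h1 := hA.nxt_lt i hi
    rcases hA.nxt_eq i hi with h2 | h2
    · exact .inl h2
    · by_cases h3 : A 2 (i + 1) = 0
      · exact .inl h3
      · right
        obtain ⟨k, hk⟩ : ∃ k, A 2 (i + 1) = k + 1 := ⟨A 2 (i + 1) - 1, by omega⟩
        rw [hk, hA.atom_getD (by omega), hA.atom_getD hi] at h2
        rw [hk, hl, List.getD_append _ _ _ _ hq, ← hcur, ← h2]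
        rfl
  · intro J hJ
    unfold fire
    split_ifs with hf
    · intro a ha
      rcases List.mem_append.1 ha with ha | ha
      · exact h.sound J hJ a ha
      · rw [List.mem_singleton] at ha
        rw [ha]
        exact hJ.2 r hrle fun j hj => h.sound J hJ _ (hf.1 j hj)
    · exact h.sound J hJ
  · intro r' hr' hbody
    by_cases hrr : r' = r
    · rw [hrr] at hbody ⊢
      by_cases hmem : vals.getD ((W + 1) * r + W) 0 ∈ Q
      · exact hsub _ hmem
      · have hb : ∀ j < W, vals.getD ((W + 1) * r + j) 0 ∈ Q := fun j hj => by
          have := hbody j hj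
          rw [hl, processed_append hq] at this
          exact mem_of_processed this
        rw [fire, if_pos ⟨hb, hmem⟩]
        simp
    · refine hsub _ (h.complete r' hr' fun j hj => hproc _ (by omega) ?_ ?_ (hbody j hj))
      · rw [Nat.mul_add, mul_one] at hr'; omega
      · intro hs
        apply hrr
        have : i = (W + 1) * r' + j := by omega
        rw [hr, Nat.add_sub_cancel, this, Nat.mul_add_div (by omega), Nat.div_eq_of_lt (by omega),
          add_zero]
  · unfold unprocessed
    rw [Nat.add_one_le_iff]
    refine Finset.card_lt_card (Finset.ssubset_iff_subset_ne.2 ⟨?_, ?_⟩)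
    · intro s hs
      rw [Finset.mem_filter] at hs ⊢
      exact ⟨hs.1, fun h1 => hs.2 (hproc' s h1)⟩
    · intro heq
      have h1 : i + 1 ∈ (Finset.Icc 1 vals.length).filter
          fun s => ¬ Processed vals Q qh (i + 1) s :=
        Finset.mem_filter.2 ⟨Finset.mem_Icc.2 ⟨by omega, hi⟩, hnot⟩
      rw [← heq, Finset.mem_filter] at h1
      exact h1.2 hnew

-- At `cur = 0` all slots of the current atom count as processed, which is also what advancing `qh`
-- says; no slot lies above the head of the next list. So the set of processed slots is unchanged.
-- If the queue is exhausted, the default atom `0` is harmless, because the second alternative of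
-- `Processed` then fails.
open Classical in
theorem SolverInv.pop {W n : ℕ} {vals Q : List ℕ} {qh : ℕ} {A : ℕ → ℕ → ℕ}
    (h : SolverInv W n vals Q qh 0) (hA : Occ W vals A) (hq : qh < Q.length) :
    SolverInv W n vals Q (qh + 1) (A 4 (Q.getD (qh + 1) 0)) ∧
      unprocessed vals Q (qh + 1) (A 4 (Q.getD (qh + 1) 0)) ≤ unprocessed vals Q qh 0 := by
  have htake : Q.take (qh + 1) = Q.take qh ++ [Q.getD qh 0] := by
    rw [List.getD_eq_getElem _ _ hq, List.take_append_getElem]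
  have hproc : ∀ s, 1 ≤ s → s ≤ vals.length →
      (Processed vals Q (qh + 1) (A 4 (Q.getD (qh + 1) 0)) s ↔ Processed vals Q qh 0 s) := by
    intro s h1 h2
    obtain ⟨k, rfl⟩ : ∃ k, s = k + 1 := ⟨s - 1, by omega⟩
    constructor
    · rintro (h4 | ⟨h4, h5, h6⟩)
      · rw [htake, List.mem_append, List.mem_singleton] at h4
        rcases h4 with h4 | h4
        · exact .inl h4
        · exact .inr ⟨hq, h4.symm, by omega⟩
      · have := hA.hd_gap _ _ h6 h2
        rw [hA.atom_getD (by omega)] at this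
        exact absurd h5.symm this
    · rintro (h4 | ⟨h4, h5, h6⟩)
      · left; rw [htake]; exact List.mem_append_left _ h4
      · left; rw [htake, h5]; simp
  refine ⟨⟨h.nodup, h.lt, h.zero_mem, hq, hA.hd_le _, ?_, h.sound, ?_⟩, ?_⟩
  · intro _
    by_cases h3 : A 4 (Q.getD (qh + 1) 0) = 0
    · exact .inl h3
    · right
      have h4 := hA.hd_le (Q.getD (qh + 1) 0)
      have h5 := (hA.hd_eq (Q.getD (qh + 1) 0)).resolve_left h3
      obtain ⟨k, hk⟩ : ∃ k, A 4 (Q.getD (qh + 1) 0) = k + 1 :=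
        ⟨A 4 (Q.getD (qh + 1) 0) - 1, by omega⟩
      rw [hk, hA.atom_getD (by omega)] at h5
      rw [hk, ← h5]
      rfl
  · intro r hr hbody
    refine h.complete r hr fun j hj => (hproc _ (by omega) ?_).1 (hbody j hj)
    rw [Nat.mul_add, mul_one] at hr; omega
  · unfold unprocessed
    refine Finset.card_le_card fun s hs => ?_
    rw [Finset.mem_filter] at hs ⊢
    have h1 := Finset.mem_Icc.1 hs.1
    rw [hproc s h1.1 h1.2] at hs
    exact hs

/-- The assumption `0 < W` matters: a rule with an empty body would have to fire before any slot is
visited. After padding, such rules are triggered by the true atom `0`. -/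
theorem SolverInv.init {W n : ℕ} {vals : List ℕ} {A : ℕ → ℕ → ℕ} (hA : Occ W vals A)
    (hW : 0 < W) (hn : 0 < n) : SolverInv W n vals [0] 0 (A 4 0) := by
  refine ⟨by simp, by simpa using hn, by simp, by simp, hA.hd_le _, ?_, ?_, ?_⟩
  · intro _
    by_cases h3 : A 4 0 = 0
    · exact .inl h3
    · right
      have h4 := hA.hd_le 0
      have h5 := (hA.hd_eq 0).resolve_left h3
      obtain ⟨k, hk⟩ : ∃ k, A 4 0 = k + 1 := ⟨A 4 0 - 1, by omega⟩
      rw [hk, hA.atom_getD (by omega)] at h5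
      simpa [hk] using h5
  · intro J hJ a ha
    rw [List.mem_singleton] at ha
    rw [ha]
    exact hJ.1
  · intro r hr hbody
    rw [Nat.mul_add, mul_one] at hr
    rcases hbody 0 hW with h1 | ⟨-, h2, h3⟩
    · simp at h1
    · have := hA.hd_gap 0 _ h3 (by omega)
      rw [hA.atom_getD (by omega)] at this
      exact absurd h2.symm this

/-- Once the queue is exhausted, all slots of its atoms are processed, so `complete` says that the
queue is itself closed; by `sound` it is the least closed set. -/
theorem SolverInv.mem_iff {W n : ℕ} {vals Q : List ℕ} {qh cur : ℕ}
    (h : SolverInv W n vals Q qh cur) (hq : Q.length ≤ qh) (a : ℕ) :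
    a ∈ Q ↔ ∀ J, RuleClosed W vals J → a ∈ J := by
  refine ⟨fun ha J hJ => h.sound J hJ a ha, fun hall => hall {a | a ∈ Q} ⟨h.zero_mem, ?_⟩⟩
  intro r hr hbody
  refine h.complete r hr fun j hj => .inl ?_
  rw [List.take_of_length_le hq]
  exact hbody j hj

end WordRAM

/-! ### Forward chaining on the machine -/

namespace WordRAM

/-- The state of the machine during the solution of the Horn formula. -/
structure Solving (P : Params) (vals Q : List ℕ) (qh cur : ℕ) (σ : State) : Prop where
  bases : Bases P.Z σ.reg
  r25 : σ.reg 25 = 0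
  r30 : σ.reg 30 = qh
  r31 : σ.reg 31 = Q.length
  r32 : σ.reg 32 = cur
  mem : ∃ A, σ.mem = layout P.Z P.inp A ∧ Occ P.W vals A ∧ (∀ a, A 5 a = if a ∈ Q then 1 else 0) ∧
    ∀ i, A 6 i = Q.getD i 0

/-- Register `33` is set to `0` unless the atoms of `n` slots from register `34` on are true. -/
def checkBody : ℕ → Program
  | 0 => .skip
  | n + 1 => .seq (loadArr 1 35 34) (.seq (loadArr 5 36 35) (.seq (.mul 33 33 36)
      (.seq (.add 34 34 1) (checkBody n))))

/-- The conjunction is computed as a product of truth values `0` and `1`; the proposition `p` is the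
part already evaluated. As `n` is a constant of the program, no loop is needed. -/
theorem wp_checkBody {B Z N : ℕ} {inp : ℕ → ℕ} {A : ℕ → ℕ → ℕ} {Q : List ℕ}
    (h5 : ∀ a, A 5 a = if a ∈ Q then 1 else 0) (n f : ℕ)
    (hN : ∀ j < n, A 1 (f + j) < N) (hB : Z + 8 * (N + f + n) + 16 ≤ B)
    {σ : State} (hb : Bases Z σ.reg) (hm : σ.mem = layout Z inp A)
    (p : Prop) [Decidable p] (h33 : σ.reg 33 = if p then 1 else 0) (h34 : σ.reg 34 = f) :
    wp B (checkBody n) (fun τ => τ.mem = σ.mem ∧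
      τ.reg 33 = (if p ∧ ∀ j < n, A 1 (f + j) ∈ Q then 1 else 0) ∧ τ.reg 34 = f + n ∧
      ∀ i, i ≠ 20 → i ≠ 33 → i ≠ 34 → i ≠ 35 → i ≠ 36 → τ.reg i = σ.reg i) σ := by
  induction n generalizing f σ p with
  | zero => exact ⟨rfl, by simpa using h33, by simpa using h34, fun i _ _ _ _ _ => rfl⟩
  | succ n ih =>
    have hf := hN 0 (by omega)
    rw [add_zero] at hf
    have h51 : A 5 (A 1 f) ≤ 1 := by rw [h5]; split_ifs <;> omega
    have h331 : σ.reg 33 ≤ 1 := by rw [h33]; split_ifs <;> omega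
    have hmul : σ.reg 33 * A 5 (A 1 f) ≤ 1 := Nat.mul_le_mul h331 h51
    refine wp_loadArr hb hm (by norm_num) (by norm_num) (by omega) (by rw [h34]; omega) ?_
    refine wp_loadArr (A := A) (inp := inp) (hb.congr ?_) hm (by norm_num) (by norm_num) ?_ ?_ ?_
    · intro i hi
      have e1 : i ≠ 20 := by omega
      have e2 : i ≠ 35 := by omega
      simp [e1, e2]
    · simp [h34]; omega
    · simp [h34]; omega
    refine ⟨?_, ?_, ?_⟩
    · simp [h34]; omega
    · simp [h34, hb.1]; omega
    refine wp_mono ?_ (ih (f + 1) ?_ (by omega) (hb.congr ?_) ?_ (p ∧ A 1 f ∈ Q) ?_ ?_)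
    · rintro τ ⟨h6, h7, h8, h9⟩
      refine ⟨h6, ?_, by omega, ?_⟩
      · rw [h7]
        refine if_congr ?_ rfl rfl
        rw [and_assoc]
        refine and_congr_right fun _ => ⟨fun ⟨h10, h11⟩ j hj => ?_, fun h10 => ⟨?_, fun j hj => ?_⟩⟩
        · rcases j with _ | j
          · exact h10
          · have := h11 j (by omega)
            rwa [show f + 1 + j = f + (j + 1) by omega] at this
        · exact h10 0 (by omega)
        · have := h10 (j + 1) (by omega)
          rwa [show f + (j + 1) = f + 1 + j by omega] at this
      · intro i h10 h11 h12 h13 h14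
        rw [h9 i h10 h11 h12 h13 h14]
        simp [h10, h11, h12, h13, h14]
    · intro j hj
      have := hN (j + 1) (by omega)
      rwa [show f + (j + 1) = f + 1 + j by omega] at this
    · intro i hi
      have e1 : i ≠ 20 := by omega
      have e2 : i ≠ 33 := by omega
      have e3 : i ≠ 34 := by omega
      have e4 : i ≠ 35 := by omega
      have e5 : i ≠ 36 := by omega
      simp [e1, e2, e3, e4, e5]
    · exact hm
    · simp only [State.reg_setReg]
      norm_num
      rw [h33, h34, h5]
      by_cases c : p <;> by_cases c' : A 1 f ∈ Q <;> simp [c, c']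
    · simp [h34, hb.1]

/-- One round of the solver. -/
def solveBody (W : ℕ) : Program :=
  .ifLt 25 32
    (.seq (loadArr 3 34 32) (.seq (.const 33 1) (.seq (checkBody W) (.seq (loadArr 1 35 34)
      (.seq (loadArr 5 36 35) (.seq
        (.ifLt 36 33 (.seq (storeArr 5 35 1) (.seq (storeArr 6 31 35) (.add 31 31 1))) .skip)
        (loadArr 2 32 32)))))))
    (.seq (.add 30 30 1) (.seq (loadArr 6 35 30) (loadArr 4 32 35)))

theorem wp_solveBody_pop {P : Params} {vals Q : List ℕ} {qh n B : ℕ}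
    (hB : P.Z + 8 * (n + vals.length) + 16 ≤ B) (hi : SolverInv P.W n vals Q qh 0)
    (hq : qh < Q.length) {σ : State} (h : Solving P vals Q qh 0 σ) :
    wp B (solveBody P.W) (fun τ => ∃ cur', Solving P vals Q (qh + 1) cur' τ ∧
      SolverInv P.W n vals Q (qh + 1) cur' ∧
      unprocessed vals Q (qh + 1) cur' ≤ unprocessed vals Q qh 0) σ := by
  obtain ⟨hb, h25, h30, h31, h32, A, hm, hA, h5, h6⟩ := h
  have hl := hi.length_le
  -- Past the end of the queue, array `6` still holds its initial `0`, so the superfluous load is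
  -- safe.
  have hget : Q.getD (qh + 1) 0 ≤ n := by
    by_cases hc : qh + 1 < Q.length
    · rw [List.getD_eq_getElem _ _ hc]
      exact (hi.lt _ (List.getElem_mem hc)).le
    · rw [List.getD_eq_default _ _ (by omega)]; omega
  have hhd := hA.hd_le (Q.getD (qh + 1) 0)
  obtain ⟨hi1, hi2⟩ := hi.pop hA hq
  -- Register `25` holds the constant `0`, so the test asks whether `cur` is positive.
  refine ⟨fun hlt => absurd hlt (by omega), fun _ => ⟨by rw [h30, hb.1]; omega, ?_⟩⟩
  refine wp_loadArr (A := A) (inp := P.inp) (hb.congr ?_) hm (by norm_num) (by norm_num) ?_ ?_ ?_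
  · intro i hi
    have e1 : i ≠ 30 := by omega
    simp [e1]
  · simp [h30, hb.1]; omega
  · simp only [State.reg_setReg, if_true, h30, hb.1, h6]; omega
  refine wp_loadArr (A := A) (inp := P.inp) (hb.congr ?_) hm (by norm_num) (by norm_num) ?_ ?_ ?_
  · intro i hi
    have e1 : i ≠ 30 := by omega
    have e2 : i ≠ 20 := by omega
    have e3 : i ≠ 35 := by omega
    simp [e1, e2, e3]
  · simp only [State.reg_setReg, if_true, h30, hb.1, h6]; omega
  · simp only [State.reg_setReg, if_true, h30, hb.1, h6]; omega
  refine ⟨_, ⟨hb.congr ?_, ?_, ?_, ?_, ?_, A, hm, hA, h5, h6⟩, hi1, hi2⟩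
  · intro i hi
    have e1 : i ≠ 30 := by omega
    have e2 : i ≠ 20 := by omega
    have e3 : i ≠ 35 := by omega
    have e4 : i ≠ 32 := by omega
    simp [e1, e2, e3, e4]
  · simp [h25]
  · simp [h30, hb.1]
  · simp [h31]
  · simp [h30, hb.1, h6]

theorem wp_solveBody_slot {P : Params} {vals Q : List ℕ} {qh cur n B : ℕ}
    (hB : P.Z + 8 * (n + vals.length) + 16 ≤ B) (hv : ∀ x ∈ vals, x < n)
    (hd : P.W + 1 ∣ vals.length) (hi : SolverInv P.W n vals Q qh cur)
    (hq : qh < Q.length) (hc : 0 < cur) {σ : State} (h : Solving P vals Q qh cur σ) :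
    wp B (solveBody P.W) (fun τ => ∃ Q' cur', Solving P vals Q' qh cur' τ ∧
      SolverInv P.W n vals Q' qh cur' ∧
      unprocessed vals Q' qh cur' + 1 ≤ unprocessed vals Q qh cur) σ := by
  obtain ⟨hb, h25, h30, h31, h32, A, hm, hA, h5, h6⟩ := h
  have hl := hi.length_le
  obtain ⟨hi1, hi2⟩ := hi.slot hA hv hd hq hc
  obtain ⟨i, rfl⟩ : ∃ i, cur = i + 1 := ⟨cur - 1, by omega⟩
  have hil : i < vals.length := hi.cur_le
  rw [Nat.add_sub_cancel] at hi1 hi2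
  set r := i / (P.W + 1) with hr
  have hrul : A 3 (i + 1) = 1 + (P.W + 1) * r := hA.rul i hil
  have hrle : (P.W + 1) * (r + 1) ≤ vals.length := by
    obtain ⟨R, hR⟩ := hd
    rw [hR]
    refine Nat.mul_le_mul_left _ ?_
    rw [hr, Nat.succ_le_iff, Nat.div_lt_iff_lt_mul (by omega), mul_comm, ← hR]
    exact hil
  rw [Nat.mul_add, mul_one] at hrle
  have hatom : ∀ k < vals.length, A 1 (1 + k) = vals.getD k 0 := fun k hk => by
    rw [add_comm]; exact hA.atom_getD hk
  have hlt : ∀ k < vals.length, A 1 (1 + k) < n := fun k hk => by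
    rw [hatom k hk, List.getD_eq_getElem _ _ hk]
    exact hv _ (List.getElem_mem hk)
  have h51 : ∀ a, A 5 a ≤ 1 := fun a => by rw [h5]; split_ifs <;> omega
  have hnxt := hA.nxt_lt i hil
  refine ⟨fun _ => ?_, fun hlt => absurd (show σ.reg 25 < σ.reg 32 by omega) hlt⟩
  refine wp_loadArr hb hm (by norm_num) (by norm_num) (by rw [h32]; omega)
    (by rw [h32, hrul]; omega) ?_
  refine ⟨by omega, ?_⟩
  rw [wp_seq]
  refine wp_mono ?_ (wp_checkBody (B := B) (Z := P.Z) (inp := P.inp) (A := A) (N := n) h5 P.W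
    (1 + (P.W + 1) * r) ?_ (by omega) ?_ ?_ True ?_ ?_)
  rotate_left
  · intro j hj
    rw [add_assoc]
    exact hlt _ (by omega)
  · refine hb.congr fun i hi => ?_
    have e1 : i ≠ 20 := by omega
    have e2 : i ≠ 33 := by omega
    have e3 : i ≠ 34 := by omega
    simp [e1, e2, e3]
  · exact hm
  · simp
  · simp [h32, hrul]
  rintro τ ⟨t1, t2, t3, t4⟩
  -- After `W` body slots, register `34` has arrived at the head, the last slot of the rule.
  have hx : A 1 (τ.reg 34) = vals.getD ((P.W + 1) * r + P.W) 0 := by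
    rw [t3, add_assoc]; exact hatom _ (by omega)
  have hxlt : A 1 (τ.reg 34) < n := by
    rw [t3, add_assoc]; exact hlt _ (by omega)
  set x := vals.getD ((P.W + 1) * r + P.W) 0 with hxdef
  have tb : Bases P.Z τ.reg := hb.congr fun i hi => by
    rw [t4 i (by omega) (by omega) (by omega) (by omega) (by omega)]
    have e1 : i ≠ 20 := by omega
    have e2 : i ≠ 33 := by omega
    have e3 : i ≠ 34 := by omega
    simp [e1, e2, e3]
  have tm : τ.mem = layout P.Z P.inp A := by rw [t1]; exact hm
  have tr : ∀ i, i ≠ 20 → i ≠ 33 → i ≠ 34 → i ≠ 35 → i ≠ 36 → τ.reg i = σ.reg i :=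
    fun i a b c d e => by rw [t4 i a b c d e]; simp [a, b, c]
  have t25 : τ.reg 25 = 0 := by rw [tr 25 (by omega) (by omega) (by omega) (by omega) (by omega), h25]
  have t30 : τ.reg 30 = qh := by
    rw [tr 30 (by omega) (by omega) (by omega) (by omega) (by omega), h30]
  have t31 : τ.reg 31 = Q.length := by
    rw [tr 31 (by omega) (by omega) (by omega) (by omega) (by omega), h31]
  have t32 : τ.reg 32 = i + 1 := by
    rw [tr 32 (by omega) (by omega) (by omega) (by omega) (by omega), h32]
  have hbody : (∀ j < P.W, A 1 (1 + (P.W + 1) * r + j) ∈ Q) ↔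
      ∀ j < P.W, vals.getD ((P.W + 1) * r + j) 0 ∈ Q :=
    forall₂_congr fun j hj => by rw [add_assoc, hatom _ (by omega)]
  simp only [hbody, true_and] at t2
  refine wp_loadArr tb tm (by norm_num) (by norm_num) (by rw [t3]; omega) (by omega) ?_
  refine wp_loadArr (A := A) (inp := P.inp) (tb.congr ?_) tm (by norm_num) (by norm_num) ?_ ?_ ?_
  · intro i hi
    have e1 : i ≠ 20 := by omega
    have e2 : i ≠ 35 := by omega
    simp [e1, e2]
  · simp; omega
  · have := h51 (A 1 (τ.reg 34))
    simp; omega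
  -- Between truth values, `36 < 33` says that the head is not yet true and the whole body is: the
  -- condition in `fire`.
  refine ⟨fun hgo => ?_, fun hgo => ?_⟩
  · simp only [State.reg_setReg] at hgo
    norm_num at hgo
    rw [hx, t2, h5] at hgo
    have hcond : (∀ j < P.W, vals.getD ((P.W + 1) * r + j) 0 ∈ Q) ∧ x ∉ Q := by
      by_cases c : x ∈ Q
      · rw [if_pos c] at hgo
        split_ifs at hgo <;> omega
      · refine ⟨?_, c⟩
        by_contra c'
        rw [if_neg c'] at hgo
        omega
    have hfire : fire P.W vals Q r = Q ++ [x] := if_pos hcond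
    rw [hfire] at hi1 hi2
    have hl' := hi1.length_le
    rw [List.length_append, List.length_singleton] at hl'
    refine wp_storeArr (A := A) (inp := P.inp) (tb.congr ?_) tm (by norm_num) (by norm_num)
      (by norm_num) ?_ ?_ ?_
    · intro i hi
      have e1 : i ≠ 20 := by omega
      have e2 : i ≠ 35 := by omega
      have e3 : i ≠ 36 := by omega
      simp [e1, e2, e3]
    · simp [hx]; omega
    · simp [tb.1]; omega
    refine wp_storeArr (inp := P.inp) (tb.congr ?_) rfl (by norm_num) (by norm_num)
      (by norm_num) ?_ ?_ ?_
    · intro i hi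
      have e1 : i ≠ 20 := by omega
      have e2 : i ≠ 35 := by omega
      have e3 : i ≠ 36 := by omega
      simp [e1, e2, e3]
    · simp [t31]; omega
    · simp [hx]; omega
    refine ⟨by simp [t31, tb.1]; omega, ?_⟩
    refine wp_loadArr (inp := P.inp) (tb.congr ?_) rfl (by norm_num) (by norm_num) ?_ ?_ ?_
    · intro i hi
      have e1 : i ≠ 20 := by omega
      have e2 : i ≠ 35 := by omega
      have e3 : i ≠ 36 := by omega
      have e4 : i ≠ 31 := by omega
      simp [e1, e2, e3, e4]
    · simp [t32]; omega
    · simp [t32, setArr]; omega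
    refine ⟨_, _, ⟨tb.congr ?_, ?_, ?_, ?_, ?_, _, rfl, hA.congr ?_, ?_, ?_⟩, hi1, hi2⟩
    · intro i hi
      have e1 : i ≠ 20 := by omega
      have e2 : i ≠ 35 := by omega
      have e3 : i ≠ 36 := by omega
      have e4 : i ≠ 31 := by omega
      have e5 : i ≠ 32 := by omega
      simp [e1, e2, e3, e4, e5]
    · simp [t25]
    · simp [t30]
    · simp [t31, tb.1]
    · simp [t32, setArr]
    · intro j hj
      have e1 : j ≠ 5 := by omega
      have e2 : j ≠ 6 := by omega
      funext a
      simp [setArr, e1, e2]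
    · intro a
      simp only [State.reg_setReg, setArr, List.mem_append, List.mem_singleton, h5]
      norm_num
      rw [hx, tb.1]
      by_cases c : a = x <;> simp [c]
    · intro a
      simp only [State.reg_setReg, setArr, h6]
      norm_num
      rw [hx, t31]
      by_cases c : a = Q.length
      · simp [c]
      · rw [if_neg c]
        by_cases c' : a < Q.length
        · simp [List.getElem?_append_left c']
        · rw [List.getElem?_eq_none (by omega), List.getElem?_eq_none (by simp; omega)]
  · simp only [State.reg_setReg] at hgo
    norm_num at hgo
    rw [hx, t2, h5] at hgo
    have hfire : fire P.W vals Q r = Q := by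
      refine if_neg fun hcond => ?_
      rw [if_pos hcond.1, if_neg hcond.2] at hgo
      omega
    rw [hfire] at hi1 hi2
    refine wp_loadArr (A := A) (inp := P.inp) (tb.congr ?_) tm (by norm_num) (by norm_num) ?_ ?_ ?_
    · intro i hi
      have e1 : i ≠ 20 := by omega
      have e2 : i ≠ 35 := by omega
      have e3 : i ≠ 36 := by omega
      simp [e1, e2, e3]
    · simp [t32]; omega
    · simp [t32]; omega
    refine ⟨_, _, ⟨tb.congr ?_, ?_, ?_, ?_, ?_, _, tm, hA, h5, h6⟩, hi1, hi2⟩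
    · intro i hi
      have e1 : i ≠ 20 := by omega
      have e2 : i ≠ 35 := by omega
      have e3 : i ≠ 36 := by omega
      have e5 : i ≠ 32 := by omega
      simp [e1, e2, e3, e5]
    · simp [t25]
    · simp [t30]
    · simp [t31]
    · simp [t32]

/-- Each round processes a slot or advances `qh`, so there are at most `vals.length + n` rounds. The
measure depends on `Q`, `qh` and `cur`, which are only asserted to exist for a state, so the
induction is done directly instead of through `exists_exec_whileLt`. -/
theorem exists_exec_solve {P : Params} {vals Q : List ℕ} {qh cur n B : ℕ}
    (hB : P.Z + 8 * (n + vals.length) + 16 ≤ B) (hv : ∀ x ∈ vals, x < n)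
    (hd : P.W + 1 ∣ vals.length) (hi : SolverInv P.W n vals Q qh cur) {σ : State}
    (h : Solving P vals Q qh cur σ) :
    ∃ t τ, Exec B (.whileLt 30 31 (solveBody P.W)) σ t τ ∧
      t ≤ ((solveBody P.W).cost + 1) * (vals.length + n) + 1 ∧
      ∃ Q' qh' cur', Solving P vals Q' qh' cur' τ ∧
        ∀ a, a ∈ Q' ↔ ∀ J, RuleClosed P.W vals J → a ∈ J := by
  set K := (solveBody P.W).cost + 1 with hK
  obtain ⟨t, τ, h1, h2, h3, h4⟩ : ∃ t τ, Exec B (.whileLt 30 31 (solveBody P.W)) σ t τ ∧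
      t ≤ K * (unprocessed vals Q qh cur + (n - qh)) + 1 ∧
      (∃ Q qh cur, SolverInv P.W n vals Q qh cur ∧ Solving P vals Q qh cur τ) ∧
      ¬ τ.reg 30 < τ.reg 31 := by
    classical
    let Inv : State → Prop :=
      fun σ => ∃ Q qh cur, SolverInv P.W n vals Q qh cur ∧ Solving P vals Q qh cur σ
    have step : ∀ (m : ℕ) (σ : State), (∃ Q qh cur, SolverInv P.W n vals Q qh cur ∧
        Solving P vals Q qh cur σ ∧ unprocessed vals Q qh cur + (n - qh) = m) →
        ∃ t τ, Exec B (.whileLt 30 31 (solveBody P.W)) σ t τ ∧ t ≤ K * m + 1 ∧ Inv τ ∧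
          ¬ τ.reg 30 < τ.reg 31 := by
      intro m
      induction m using Nat.strong_induction_on with
      | _ m ih =>
        rintro σ ⟨Q, qh, cur, g1, g2, g3⟩
        by_cases hq : qh < Q.length
        · have hlt : σ.reg 30 < σ.reg 31 := by rw [g2.r30, g2.r31]; exact hq
          have hl := g1.length_le
          have hround : wp B (solveBody P.W) (fun τ => ∃ m' < m, ∃ Q qh cur,
              SolverInv P.W n vals Q qh cur ∧ Solving P vals Q qh cur τ ∧
              unprocessed vals Q qh cur + (n - qh) = m') σ := by
            rcases Nat.eq_zero_or_pos cur with rfl | hc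
            · refine wp_mono ?_ (wp_solveBody_pop hB g1 hq g2)
              rintro τ ⟨cur', k1, k2, k3⟩
              exact ⟨_, by omega, Q, qh + 1, cur', k2, k1, rfl⟩
            · refine wp_mono ?_ (wp_solveBody_slot hB hv hd g1 hq hc g2)
              rintro τ ⟨Q', cur', k1, k2, k3⟩
              exact ⟨_, by omega, Q', qh, cur', k2, k1, rfl⟩
          obtain ⟨t, ρ, e1, e2, m', e3, e4⟩ := exists_exec_of_wp hround
          obtain ⟨u, τ, e5, e6, e7⟩ := ih m' e3 ρ e4
          refine ⟨1 + t + u, τ, .whileTrue hlt e1 e5, ?_, e7⟩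
          have := Nat.mul_le_mul_left K (show m' + 1 ≤ m from e3)
          rw [Nat.mul_add, mul_one] at this
          omega
        · have hlt : ¬ σ.reg 30 < σ.reg 31 := by rw [g2.r30, g2.r31]; exact hq
          exact ⟨1, σ, .whileFalse σ hlt, by omega, ⟨Q, qh, cur, g1, g2⟩, hlt⟩
    exact step _ σ ⟨Q, qh, cur, hi, h, rfl⟩
  obtain ⟨Q', qh', cur', g1, g2⟩ := h3
  refine ⟨t, τ, h1, h2.trans ?_, Q', qh', cur', g2, g1.mem_iff ?_⟩
  · refine Nat.add_le_add_right (Nat.mul_le_mul_left K (Nat.add_le_add ?_ (Nat.sub_le _ _))) 1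
    classical
    refine (Finset.card_filter_le _ _).trans ?_
    simp
  · rw [g2.r30, g2.r31] at h4
    omega

end WordRAM

namespace WordRAM

/-! ### The complete program -/

/-- Constants, the numbers of variables and constraints, and the bases of the arrays are set, where
`N` is the number of rows per constraint and `K` a bound for the arities. -/
def initProg (N K : ℕ) : Program :=
  .seq (.const 1 1) (.seq (.const 2 8) (.seq (.load 10 25) (.seq (.load 11 1)
    (.seq (.const 20 (K + 1)) (.seq (.mul 20 11 20) (.seq (.add 20 20 1) (.seq (.add 20 20 1)
    (.seq (.add 3 20 1) (.seq (.add 4 3 1) (.seq (.add 5 4 1) (.seq (.add 6 5 1)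
    (.seq (.add 7 6 1) (.seq (.add 8 7 1) (.seq (.add 9 10 1) (.seq (.const 13 N)
    (.seq (.mul 12 11 13) (.seq (.const 15 1) (.const 18 2))))))))))))))))))

theorem wp_initProg {P : Params} {input : List ℕ} {K B : ℕ}
    (hinp : P.inp = fun i => input.getD i 0) (h0 : P.inp 0 = P.nv) (h1 : P.inp 1 = P.M)
    (hZ : P.Z = P.M * (K + 1) + 2) (hlen : input.length ≤ P.Z)
    (hB : P.Z + 8 + P.nv + P.M + P.N + P.M * P.N + K ≤ B) :
    wp B (initProg P.N K) (fun τ => Generating P 0 0 2 [] τ ∧ τ.reg 15 = 1) (initState input) := by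
  have e0 : input[0]?.getD 0 = P.nv := by
    rw [← h0, hinp]; simp
  have e1 : input[1]?.getD 0 = P.M := by
    rw [← h1, hinp]; simp
  simp only [initProg, wp, State.reg_setReg, State.mem_setReg]
  norm_num [initState, e0, e1]
  refine ⟨by omega, by omega, by omega, by omega, by omega, by omega, by omega, by omega,
    by omega, by omega, by omega, by omega, by omega, by omega, by omega, by omega, by omega,
    by omega, by omega, ⟨⟨?_, ?_, ?_⟩, ?_, ?_, ?_, ?_, ?_, ?_, ?_, ?_, ?_, ?_, ?_⟩⟩
  · simp
  · simp
  · intro j hj1 hj6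
    interval_cases j <;> simp <;> omega
  · simp
  · simp
  · simp
  · simp
  · simp
  · simp
  · simp
  · simp
  · simp
  · simp
  · refine ⟨fun _ _ => 0, ?_, ⟨⟨?_, ?_, ?_, ?_, ?_, ?_, ?_, ?_⟩, ?_, ?_⟩⟩
    · funext a
      simp only [State.mem_setReg, layout, hinp]
      split_ifs with h
      · simp
      · simp only [← List.getD_eq_getElem?_getD]
        exact List.getD_eq_default _ _ (by omega)
    all_goals simp
    intro a s h1 h2
    omega

/-- The queue of the solver is initialized with the atom `0`. -/
def startProg : Program :=
  .seq (.const 25 0) (.seq (.const 30 0) (.seq (.const 31 1) (.seq (.const 35 0)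
    (.seq (storeArr 5 35 1) (.seq (storeArr 6 35 35) (loadArr 4 32 35))))))

theorem wp_startProg {P : Params} {D p pos B : ℕ} {vals : List ℕ} (hW : 0 < P.W)
    (hB : P.Z + vals.length + 8 ≤ B) {σ : State} (h : Generating P D p pos vals σ) :
    wp B startProg (fun τ => ∃ cur, Solving P vals [0] 0 cur τ ∧
      SolverInv P.W P.atoms vals [0] 0 cur) σ := by
  obtain ⟨A, hm, hA⟩ := h.mem
  have hhd := hA.hd_le 0
  refine ⟨by omega, by omega, by omega, by omega, ?_⟩
  refine wp_storeArr (A := A) (inp := P.inp) (h.bases.congr ?_) hm (by norm_num) (by norm_num)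
      (by norm_num) ?_ ?_ ?_
  · intro i hi
    simp only [State.reg_setReg]
    rw [if_neg (by omega), if_neg (by omega), if_neg (by omega), if_neg (by omega)]
  · simp; omega
  · simp [h.bases.1]; omega
  refine wp_storeArr (inp := P.inp) (h.bases.congr ?_) rfl (by norm_num) (by norm_num)
      (by norm_num) ?_ ?_ ?_
  · intro i hi
    simp only [State.reg_setReg]
    rw [if_neg (by omega), if_neg (by omega), if_neg (by omega), if_neg (by omega),
      if_neg (by omega)]
  · simp; omega
  · simp
  refine wp_loadArr (inp := P.inp) (h.bases.congr ?_) rfl (by norm_num) (by norm_num) ?_ ?_ ?_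
  · intro i hi
    simp only [State.reg_setReg]
    rw [if_neg (by omega), if_neg (by omega), if_neg (by omega), if_neg (by omega),
      if_neg (by omega), if_neg (by omega)]
  · simp; omega
  · simp [setArr]; omega
  refine ⟨_, ⟨h.bases.congr ?_, ?_, ?_, ?_, ?_, _, rfl, hA.toOcc.congr ?_, ?_, ?_⟩,
    SolverInv.init hA.toOcc hW (by simp [Params.atoms])⟩
  · intro i hi
    simp only [State.reg_setReg]
    rw [if_neg (by omega), if_neg (by omega), if_neg (by omega), if_neg (by omega),
      if_neg (by omega), if_neg (by omega), if_neg (by omega), if_neg (by omega)]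
  · simp
  · simp
  · simp
  · simp [setArr]
  · intro j hj
    have e1 : j ≠ 5 := by omega
    have e2 : j ≠ 6 := by omega
    funext a
    simp [setArr, e1, e2]
  · intro a
    simp [setArr, h.bases.1, hA.val_eq]
  · intro a
    simp only [State.reg_setReg, setArr, hA.queue_eq]
    rcases a with _ | a <;> simp

/-- The answer is `1` if the atom `1` is not derivable. -/
def endProg : Program :=
  .seq (loadArr 5 36 1) (.sub 0 1 36)

theorem wp_endProg {P : Params} {B qh cur : ℕ} {vals Q : List ℕ} (hB : P.Z + 16 ≤ B) {σ : State}
    (h : Solving P vals Q qh cur σ) :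
    wp B endProg (fun τ => τ.reg 0 = 1 ↔ 1 ∉ Q) σ := by
  obtain ⟨A, hm, -, h5, -⟩ := h.mem
  have h51 : A 5 1 ≤ 1 := by rw [h5]; split_ifs <;> omega
  refine wp_loadArr h.bases hm (by norm_num) (by norm_num) (by rw [h.bases.1]; omega)
    (by rw [h.bases.1]; omega) ⟨?_, ?_⟩
  · simp [h.bases.1]; omega
  · simp only [State.reg_setReg]
    norm_num [h.bases.1, h5]
    by_cases c : 1 ∈ Q <;> simp [c]

/-! ### The words of the input -/

/-- The input for `nv` variables and the constraints `cs`, each given by its symbol and its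
arguments. -/
def inputOf (nv : ℕ) (cs : List (ℕ × List ℕ)) : List ℕ :=
  nv :: cs.length :: cs.flatMap fun C => C.1 :: C.2

/-- The position of constraint `D` in the input. -/
def posOf (cs : List (ℕ × List ℕ)) (D : ℕ) : ℕ :=
  2 + ((cs.take D).flatMap fun C => C.1 :: C.2).length

/-- The parameters of an input. -/
def paramsOf (N W K nv : ℕ) (cs : List (ℕ × List ℕ)) : Params where
  nv := nv
  M := cs.length
  N := N
  W := W
  Z := cs.length * (K + 1) + 2
  inp := fun i => (inputOf nv cs).getD i 0

/-- The symbol of constraint `D`. -/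
def symOf (cs : List (ℕ × List ℕ)) (D : ℕ) : ℕ := (cs.getD D (0, [])).1

/-- The arguments of constraint `D`. -/
def argOf (cs : List (ℕ × List ℕ)) (D i : ℕ) : ℕ := (cs.getD D (0, [])).2.getD i 0

theorem inputOf_getD (nv : ℕ) {cs : List (ℕ × List ℕ)} {D : ℕ} (hD : D < cs.length) (i : ℕ)
    (hi : i < (cs[D].1 :: cs[D].2).length) :
    (inputOf nv cs).getD (posOf cs D + i) 0 = (cs[D].1 :: cs[D].2).getD i 0 := by
  have h : cs.flatMap (fun C => C.1 :: C.2) = (cs.take D).flatMap (fun C => C.1 :: C.2) ++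
      ((cs[D].1 :: cs[D].2) ++ (cs.drop (D + 1)).flatMap fun C => C.1 :: C.2) := by
    conv_lhs => rw [← List.take_append_drop D cs, List.drop_eq_getElem_cons hD]
    rw [List.flatMap_append, List.flatMap_cons]
  rw [inputOf, h, posOf, show 2 + ((cs.take D).flatMap fun C => C.1 :: C.2).length + i
    = (((cs.take D).flatMap fun C => C.1 :: C.2).length + i) + 1 + 1 by omega,
    List.getD_cons_succ, List.getD_cons_succ, List.getD_append_right _ _ _ _ (by omega),
    Nat.add_sub_cancel_left, List.getD_append _ _ _ _ hi]

theorem length_flatMap_le {cs : List (ℕ × List ℕ)} {K : ℕ} (h : ∀ C ∈ cs, C.2.length ≤ K) :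
    (cs.flatMap fun C => C.1 :: C.2).length ≤ cs.length * (K + 1) := by
  induction cs with
  | nil => simp
  | cons C cs ih =>
    have h1 := ih fun C hC => h C (List.mem_cons_of_mem _ hC)
    have h2 := h C (by simp)
    rw [List.flatMap_cons, List.length_append, List.length_cons, List.length_cons, Nat.add_mul,
      one_mul]
    omega

theorem stored_paramsOf {nR : ℕ} {ar : ℕ → ℕ} {N W K nv : ℕ} {cs : List (ℕ × List ℕ)}
    (hK : ∀ r < nR, ar r ≤ K)
    (hcs : ∀ C ∈ cs, C.1 < nR ∧ C.2.length = ar C.1 ∧ ∀ x ∈ C.2, x < nv) :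
    Stored (paramsOf N W K nv cs) nR ar (symOf cs) (argOf cs) (posOf cs) := by
  have hget : ∀ D (hD : D < cs.length), cs.getD D (0, []) = cs[D] :=
    fun D hD => List.getD_eq_getElem _ _ hD
  have hmem : ∀ D (hD : D < cs.length), cs[D].1 < nR ∧ cs[D].2.length = ar cs[D].1 ∧
    ∀ x ∈ cs[D].2, x < nv := fun D hD => hcs _ (List.getElem_mem hD)
  refine ⟨fun D hD => ?_, fun D hD => ?_, fun D hD => ?_, fun D hD => ?_, fun D hD i hi => ?_,
    fun D hD i hi => ?_⟩
  · change D < cs.length at hD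
    rw [symOf, hget D hD, ← (hmem D hD).2.1, posOf, posOf, List.take_succ_eq_append_getElem hD,
      List.flatMap_append]
    simp
    omega
  · change D ≤ cs.length at hD
    change posOf cs D ≤ cs.length * (K + 1) + 2
    have h1 := length_flatMap_le (cs := cs.take D) (K := K) fun C hC => by
      have := hcs C (List.mem_of_mem_take hC)
      rw [this.2.1]; exact hK _ this.1
    rw [List.length_take, min_eq_left hD] at h1
    have h2 := Nat.mul_le_mul_right (K + 1) hD
    unfold posOf
    omega
  · change D < cs.length at hD
    rw [symOf, hget D hD]
    exact (hmem D hD).1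
  · change D < cs.length at hD
    have := inputOf_getD nv hD 0 (by simp)
    rw [add_zero] at this
    rw [symOf, hget D hD]
    exact this
  · change D < cs.length at hD
    rw [symOf, hget D hD, ← (hmem D hD).2.1] at hi
    have := inputOf_getD nv hD (i + 1) (by simpa using hi)
    rw [argOf, hget D hD]
    rw [List.getD_cons_succ] at this
    exact this
  · change D < cs.length at hD
    rw [symOf, hget D hD, ← (hmem D hD).2.1] at hi
    rw [argOf, hget D hD, List.getD_eq_getElem _ _ hi]
    exact (hmem D hD).2.2 _ (List.getElem_mem hi)

theorem length_inputOf_le {cs : List (ℕ × List ℕ)} {K : ℕ} (h : ∀ C ∈ cs, C.2.length ≤ K)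
    (nv : ℕ) : (inputOf nv cs).length ≤ cs.length * (K + 1) + 2 := by
  have := length_flatMap_le h
  simp only [inputOf, List.length_cons]
  omega

/-- Every constraint contributes at least the word for its symbol, so the number of constraints is
bounded by the input size. -/
theorem le_length_inputOf (cs : List (ℕ × List ℕ)) (nv : ℕ) :
    cs.length + 2 ≤ (inputOf nv cs).length := by
  have : cs.length ≤ (cs.flatMap fun C => C.1 :: C.2).length := by
    induction cs with
    | nil => simp
    | cons C cs ih => simp only [List.flatMap_cons, List.length_append, List.length_cons]; omega
  simp only [inputOf, List.length_cons]
  omega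

theorem rulesUpTo_lt {P : Params} {nR : ℕ} {ar : ℕ → ℕ} {tpl : ℕ → List (List AtomExpr)}
    {sym : ℕ → ℕ} {arg : ℕ → ℕ → ℕ} {pos : ℕ → ℕ} (ht : Templates nR ar P.N P.W tpl)
    (hs : Stored P nR ar sym arg pos) : ∀ x ∈ rulesUpTo P tpl sym arg P.M 0, x < P.atoms := by
  intro x hx
  simp only [rulesUpTo, List.range_zero, List.flatMap_nil, List.append_nil, List.mem_flatMap,
    List.mem_range, rulesFor, List.mem_map] at hx
  obtain ⟨D, hD, p, hp, b, hb, e, he, rfl⟩ := hx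
  have hsym := hs.sym_lt D hD
  refine AtomExpr.val_lt (pos := pos D) hp ?_
  cases e with
  | tt => trivial
  | fail => trivial
  | cell row col =>
    have hD2 := Nat.mul_le_mul_right P.N (show D + 1 ≤ P.M from hD)
    rw [Nat.add_mul, one_mul] at hD2
    refine ⟨fun c hc => ?_, fun i hi => ?_⟩
    · have := ht.row_lt _ hsym b hb row col he c hc
      omega
    · have h1 := ht.col_lt _ hsym b hb row col he i hi
      have h2 := hs.pos_succ D hD
      have h3 := hs.pos_le (D + 1) hD
      exact ⟨hs.inp_arg D hD i h1, (hs.arg_lt D hD i h1).le, by omega⟩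

/-- The program that decides whether atom `1` follows from the rules. -/
def mainProg (nR : ℕ) (ar : ℕ → ℕ) (tpl : ℕ → List (List AtomExpr)) (N W K : ℕ) : Program :=
  .seq (initProg N K) (.seq (.whileLt 16 11 (genBody nR ar tpl)) (.seq startProg
    (.seq (.whileLt 30 31 (solveBody W)) endProg)))

theorem exists_exec_mainProg {P : Params} {nR : ℕ} {ar : ℕ → ℕ} {tpl : ℕ → List (List AtomExpr)}
    {sym : ℕ → ℕ} {arg : ℕ → ℕ → ℕ} {pos : ℕ → ℕ} {K T B : ℕ} {input : List ℕ}
    (ht : Templates nR ar P.N P.W tpl) (hW : 0 < P.W)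
    (hs : Stored P nR ar sym arg pos) (hT : ∀ r < nR, (tpl r).flatten.length ≤ T)
    (hK : ∀ r < nR, ar r ≤ K) (hinp : P.inp = fun i => input.getD i 0) (h0 : P.inp 0 = P.nv)
    (h1 : P.inp 1 = P.M) (hZ : P.Z = P.M * (K + 1) + 2) (hlen : input.length ≤ P.Z)
    (hpos : pos 0 = 2)
    (hB : P.Z + 8 * (P.atoms + P.M * (P.M * P.N) * T) + P.nv + P.M + P.M * P.N + P.N + nR + K + 16
      ≤ B) :
    ∃ t τ, Exec B (mainProg nR ar tpl P.N P.W K) (initState input) t τ ∧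
      t ≤ (initProg P.N K).cost + startProg.cost + endProg.cost + 2 +
        ((genBody nR ar tpl).cost + 1) * (P.M * (P.M * P.N + 1)) +
        ((solveBody P.W).cost + 1) * (P.M * (P.M * P.N) * T + P.atoms) ∧
      (τ.reg 0 = 1 ↔ ∃ J, RuleClosed P.W (rulesUpTo P tpl sym arg P.M 0) J ∧ 1 ∉ J) := by
  have hvlen := length_rulesUpTo_le hT hs le_rfl (p := 0) (fun _ => rfl) (tpl := tpl)
  rw [add_zero] at hvlen
  have hsmall : ∀ r < nR, ∀ b ∈ tpl r, ∀ e ∈ b, e.Small B := by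
    intro r hr b hb e he
    cases e with
    | tt => trivial
    | fail => trivial
    | cell row col =>
      refine ⟨fun c hc => ?_, fun i hi => ?_⟩
      · have := ht.row_lt r hr b hb row col he c hc
        omega
      · have := ht.col_lt r hr b hb row col he i hi
        have := hK r hr
        omega
  obtain ⟨t1, σ1, x1, y1, z1, w1⟩ := exists_exec_of_wp (wp_initProg (P := P) (K := K) (B := B)
    (input := input) hinp h0 h1 hZ hlen (by omega))
  rw [← hpos] at z1
  obtain ⟨t2, σ2, x2, y2, z2⟩ := exists_exec_gen (B := B) (T := T) ht hs hT hsmall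
    (fun r hr => ⟨by omega, by have := hK r hr; omega⟩) (by omega) (by omega) z1 w1
  obtain ⟨t3, σ3, x3, y3, cur, z3, w3⟩ := exists_exec_of_wp (wp_startProg (B := B) hW (by omega) z2)
  obtain ⟨t4, σ4, x4, y4, Q, qh, cur', z4, w4⟩ := exists_exec_solve (B := B) (n := P.atoms)
    (by omega) (rulesUpTo_lt ht hs)
    (dvd_length_rulesUpTo ht hs le_rfl (fun _ => rfl)) w3 z3
  obtain ⟨t5, σ5, x5, y5, z5⟩ := exists_exec_of_wp (wp_endProg (B := B) (by omega) z4)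
  refine ⟨_, σ5, .seq x1 (.seq x2 (.seq x3 (.seq x4 x5))), ?_, ?_⟩
  · have h2 := Nat.mul_le_mul_left ((solveBody P.W).cost + 1)
      (Nat.add_le_add_right hvlen P.atoms)
    omega
  -- Atom `1` is outside the least closed set iff some closed set omits it.
  · rw [z5, w4]
    simp only [not_forall, exists_prop]

/-- A program that decides in quadratic time whether atom `1` follows from the rules that are given
by templates for the constraints of the input. -/
theorem exists_program {nR : ℕ} {ar : ℕ → ℕ} {N W : ℕ} {tpl : ℕ → List (List AtomExpr)}
    (ht : Templates nR ar N W tpl) (hW : 0 < W) :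
    ∃ (p : Program) (c K : ℕ), ∀ (nv : ℕ) (cs : List (ℕ × List ℕ)),
      (∀ C ∈ cs, C.1 < nR ∧ C.2.length = ar C.1 ∧ ∀ x ∈ C.2, x < nv) →
      ∃ t τ, Exec (c * (nv + (inputOf nv cs).length) ^ c) p (initState (inputOf nv cs)) t τ ∧
        t ≤ c * (nv + (inputOf nv cs).length) ^ 2 ∧
        (τ.reg 0 = 1 ↔ ∃ J, RuleClosed W (rulesUpTo (paramsOf N W K nv cs) tpl (symOf cs)
          (argOf cs) cs.length 0) J ∧ 1 ∉ J) := by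
  obtain ⟨K, hK⟩ : ∃ K, ∀ r < nR, ar r ≤ K :=
    ⟨(Finset.range nR).sup ar, fun r hr => Finset.le_sup (f := ar) (Finset.mem_range.2 hr)⟩
  obtain ⟨T, hT⟩ : ∃ T, ∀ r < nR, (tpl r).flatten.length ≤ T :=
    ⟨(Finset.range nR).sup fun r => (tpl r).flatten.length,
      fun r hr => Finset.le_sup (f := fun r => (tpl r).flatten.length) (Finset.mem_range.2 hr)⟩
  obtain ⟨C0, hC0⟩ : ∃ C0, (initProg N K).cost + startProg.cost + endProg.cost + 2 = C0 := ⟨_, rfl⟩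
  obtain ⟨Kg, hKg⟩ : ∃ Kg, (genBody nR ar tpl).cost + 1 = Kg := ⟨_, rfl⟩
  obtain ⟨Ks, hKs⟩ : ∃ Ks, (solveBody W).cost + 1 = Ks := ⟨_, rfl⟩
  -- The summands before the parenthesis in the last line bound the word size and that parenthesis
  -- the running time, both in units of `n ^ 2`. The constant `40` also ensures `2 ≤ c`, so that `c
  -- * n ^ 2 ≤ c * n ^ c`.
  obtain ⟨c, hc⟩ : ∃ c, c = nR + 2 * K + 8 * (N + 1 + N * T) + 2 * N + 40 +
    (C0 + Kg * (N + 1) + Ks * (N * T + (N + 1))) := ⟨_, rfl⟩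
  refine ⟨mainProg nR ar tpl N W K, c, K, fun nv cs hcs => ?_⟩
  have hMn := le_length_inputOf cs nv
  have hlen := length_inputOf_le (cs := cs) (K := K) (fun C hC => by
    have := hcs C hC
    rw [this.2.1]; exact hK _ this.1) nv
  obtain ⟨n, hn⟩ : ∃ n, n = nv + (inputOf nv cs).length := ⟨_, rfl⟩
  rw [← hn]
  have n2 : 2 ≤ n := by omega
  have hnn : n ≤ n ^ 2 := by nlinarith
  have n4 : 4 ≤ n ^ 2 := by nlinarith
  have hM : cs.length ≤ n := by omega
  have hnv : nv + 1 ≤ n := by omega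
  have hMN : cs.length * N ≤ N * n := by
    rw [mul_comm]; exact Nat.mul_le_mul_left N hM
  have hMN' : cs.length * N ≤ N * n ^ 2 := hMN.trans (Nat.mul_le_mul_left N hnn)
  have hatoms : (paramsOf N W K nv cs).atoms ≤ N * n ^ 2 + n ^ 2 := by
    have h1 : cs.length * N * (nv + 1) ≤ N * n * n := Nat.mul_le_mul hMN hnv
    have h2 : (paramsOf N W K nv cs).atoms = 2 + cs.length * N * (nv + 1) := rfl
    have h3 : N * n * n = N * n ^ 2 := by ring
    omega
  have hS : cs.length * (cs.length * N) * T ≤ N * T * n ^ 2 := by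
    calc cs.length * (cs.length * N) * T ≤ n * (N * n) * T :=
          Nat.mul_le_mul_right T (Nat.mul_le_mul hM hMN)
      _ = N * T * n ^ 2 := by ring
  have hZ : cs.length * (K + 1) ≤ K * n ^ 2 + n ^ 2 := by
    have h2 := Nat.mul_le_mul_right (K + 1) (hM.trans hnn)
    have h3 : n ^ 2 * (K + 1) = K * n ^ 2 + n ^ 2 := by ring
    omega
  have hnR : nR ≤ nR * n ^ 2 := Nat.le_mul_of_pos_right _ (by omega)
  have hKn : K ≤ K * n ^ 2 := Nat.le_mul_of_pos_right _ (by omega)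
  have hNn : N ≤ N * n ^ 2 := Nat.le_mul_of_pos_right _ (by omega)
  have hC0n : C0 ≤ C0 * n ^ 2 := Nat.le_mul_of_pos_right _ (by omega)
  have hcn : c * n ^ 2 = nR * n ^ 2 + 2 * (K * n ^ 2) + 8 * (N * n ^ 2 + n ^ 2 + N * T * n ^ 2)
      + 2 * (N * n ^ 2) + 40 * n ^ 2 + (C0 * n ^ 2 + Kg * (N + 1) * n ^ 2 +
      Ks * (N * T + (N + 1)) * n ^ 2) := by rw [hc]; ring
  have hB : c * n ^ 2 ≤ c * n ^ c :=
    Nat.mul_le_mul_left c (Nat.pow_le_pow_right (by omega) (by omega))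
  obtain ⟨t, τ, h1, h2, h3⟩ := exists_exec_mainProg (P := paramsOf N W K nv cs) (K := K) (T := T)
    (B := c * n ^ c) (input := inputOf nv cs) ht hW
    (stored_paramsOf hK hcs) hT hK rfl rfl rfl rfl hlen rfl (by
      change cs.length * (K + 1) + 2 + 8 * ((paramsOf N W K nv cs).atoms +
        cs.length * (cs.length * N) * T) + nv + cs.length + cs.length * N + N + nR + K + 16 ≤ _
      omega)
  refine ⟨t, τ, h1, h2.trans ?_, h3⟩
  change (initProg N K).cost + startProg.cost + endProg.cost + 2 +
    ((genBody nR ar tpl).cost + 1) * (cs.length * (cs.length * N + 1)) +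
    ((solveBody W).cost + 1) * (cs.length * (cs.length * N) * T + (paramsOf N W K nv cs).atoms) ≤ _
  rw [hC0, hKg, hKs]
  have h4 : Kg * (cs.length * (cs.length * N + 1)) ≤ Kg * (N + 1) * n ^ 2 := by
    rw [mul_assoc]
    refine Nat.mul_le_mul_left Kg ?_
    calc cs.length * (cs.length * N + 1) ≤ n * (N * n + n) := Nat.mul_le_mul hM (by omega)
      _ = (N + 1) * n ^ 2 := by ring
  have h5 : Ks * (cs.length * (cs.length * N) * T + (paramsOf N W K nv cs).atoms)
      ≤ Ks * (N * T + (N + 1)) * n ^ 2 := by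
    rw [mul_assoc Ks (N * T + (N + 1))]
    refine Nat.mul_le_mul_left Ks ?_
    rw [Nat.add_mul (N * T), Nat.add_mul N, one_mul]
    omega
  omega

end WordRAM

/-! ### Relations in `𝓔𝓘` in terms of the types of their tuples -/

namespace SetConstraint

/-- The sets of the form `{i | n ∈ v i}`. -/
def typeSet {ι : Type} (v : ι → Set ℕ) : Set (Set ι) := Set.range fun n => {i | n ∈ v i}

/-- The closure of a family of sets under intersections of non-empty subfamilies. -/
def meetClosure {ι : Type} (A : Set (Set ι)) : Set (Set ι) :=
  {β | ∃ T ⊆ A, T.Nonempty ∧ β = ⋂₀ T}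

theorem subset_meetClosure {ι : Type} (A : Set (Set ι)) : A ⊆ meetClosure A :=
  fun a ha => ⟨{a}, by simpa using ha, by simp, by simp⟩

theorem meetClosure_mono {ι : Type} {A B : Set (Set ι)} (h : A ⊆ B) :
    meetClosure A ⊆ meetClosure B := by
  rintro β ⟨T, hT, hne, rfl⟩
  exact ⟨T, hT.trans h, hne, rfl⟩

theorem sInter_mem_meetClosure {ι : Type} {A S : Set (Set ι)} (hS : S ⊆ meetClosure A)
    (hne : S.Nonempty) : ⋂₀ S ∈ meetClosure A := by
  have hS' : ∀ β ∈ S, ∃ T ⊆ A, T.Nonempty ∧ β = ⋂₀ T := fun β hβ => hS hβ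
  choose! T hT hTne hTeq using hS'
  refine ⟨⋃ β ∈ S, T β, ?_, ?_, ?_⟩
  · simp only [Set.iUnion_subset_iff]
    exact fun β hβ => hT β hβ
  · obtain ⟨β, hβ⟩ := hne
    obtain ⟨x, hx⟩ := hTne β hβ
    exact ⟨x, Set.mem_biUnion hβ hx⟩
  · ext x
    simp only [Set.mem_sInter, Set.mem_iUnion]
    constructor
    · rintro h t ⟨β, hβ, ht⟩
      have := h β hβ
      rw [hTeq β hβ] at this
      exact this t ht
    · intro h β hβ
      rw [hTeq β hβ]
      exact fun t ht => h t ⟨β, hβ, ht⟩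

theorem meetClosure_meetClosure {ι : Type} (A : Set (Set ι)) :
    meetClosure (meetClosure A) = meetClosure A := by
  refine Set.Subset.antisymm ?_ (subset_meetClosure _)
  rintro β ⟨T, hT, hne, rfl⟩
  exact sInter_mem_meetClosure hT hne

/-- Even points of `iOp` carry the types of the first tuple and odd points those of the second. A
point of `eOp` codes a finite non-empty set of points and lies in the image of a set iff all of
these points lie in that set, so its type is the intersection of their types. -/
theorem typeSet_eiOp {ι : Type} [Finite ι] (G : ℕ ≃ FinNonempty) (a : Fin 2 → ι → Set ℕ) :
    typeSet (fun j => eiOp G fun i => a i j) = meetClosure (typeSet (a 0) ∪ typeSet (a 1)) := by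
  set b : ι → Set ℕ := fun j => iOp (a 0 j) (a 1 j) with hb
  have hunion : typeSet b = typeSet (a 0) ∪ typeSet (a 1) := by
    have heven : ∀ n, {j | 2 * n ∈ b j} = {j | n ∈ a 0 j} := by
      intro n
      ext j
      simp only [hb, iOp, Set.mem_ofPred_eq, Set.mem_union]
      constructor
      · rintro (⟨x, hx, h⟩ | ⟨x, hx, h⟩)
        · rwa [show n = x by omega]
        · omega
      · exact fun h => .inl ⟨n, h, rfl⟩
    have hodd : ∀ n, {j | 2 * n + 1 ∈ b j} = {j | n ∈ a 1 j} := by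
      intro n
      ext j
      simp only [hb, iOp, Set.mem_ofPred_eq, Set.mem_union]
      constructor
      · rintro (⟨x, hx, h⟩ | ⟨x, hx, h⟩)
        · omega
        · rwa [show n = x by omega]
      · exact fun h => .inr ⟨n, h, rfl⟩
    ext β
    simp only [typeSet, Set.mem_range, Set.mem_union]
    constructor
    · rintro ⟨n, rfl⟩
      rcases Nat.even_or_odd' n with ⟨m, rfl | rfl⟩
      · exact .inl ⟨m, (heven m).symm⟩
      · exact .inr ⟨m, (hodd m).symm⟩
    · rintro (⟨n, rfl⟩ | ⟨n, rfl⟩)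
      · exact ⟨2 * n, heven n⟩
      · exact ⟨2 * n + 1, hodd n⟩
  rw [← hunion]
  have hmem : ∀ n j, n ∈ (eiOp G fun i => a i j) ↔ ((G n).1 : Set ℕ) ⊆ b j := by
    intro n j
    simp only [eiOp, eOp, finiteSubsets, Set.mem_ofPred_eq]
    constructor
    · rintro ⟨T, hT, rfl⟩
      simpa using hT
    · exact fun h => ⟨G n, h, by simp⟩
  have htype : ∀ n, {j | n ∈ (eiOp G fun i => a i j)} =
      ⋂₀ ((fun m => {j | m ∈ b j}) '' ((G n).1 : Set ℕ)) := by
    intro n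
    ext j
    simp only [Set.mem_ofPred_eq, hmem, Set.sInter_image, Set.mem_iInter]
    rfl
  ext β
  constructor
  · rintro ⟨n, rfl⟩
    exact ⟨_, Set.image_subset_range _ _, (Finset.coe_nonempty.2 (G n).2).image _, htype n⟩
  · rintro ⟨T, hT, hne, rfl⟩
    classical
    -- As `ι` is finite, so is the family `T`; finitely many points therefore realise exactly its
    -- members, and `G` codes this set of points.
    obtain ⟨T', rfl⟩ : ∃ T' : Finset (Set ι), (T' : Set (Set ι)) = T :=
      ⟨T.toFinite.toFinset, by simp⟩
    rw [typeSet, ← Set.image_univ, Finset.subset_set_image_iff] at hT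
    obtain ⟨S, -, hS⟩ := hT
    have hSne : S.Nonempty := by
      rw [← Finset.image_nonempty (f := fun m => {j | m ∈ b j}), hS]
      exact Finset.coe_nonempty.1 hne
    refine ⟨G.symm ⟨S, hSne⟩, ?_⟩
    beta_reduce
    rw [htype, Equiv.apply_symm_apply, ← hS, Finset.coe_image]

/-- All operations are pointwise, so membership of a point in a term depends only on its type. -/
theorem mem_realize_iff {ι : Type} (t : setLanguage.Term ι) {v v' : ι → Set ℕ} {n n' : ℕ}
    (h : ∀ i, n ∈ v i ↔ n' ∈ v' i) : n ∈ t.realize v ↔ n' ∈ t.realize v' := by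
  induction t with
  | var i => exact h i
  | func f ts ih =>
    cases f with
    | inter => exact and_congr (ih 0) (ih 1)
    | union => exact or_congr (ih 0) (ih 1)
    | compl => exact not_congr (ih 0)
    | empty => exact Iff.rfl
    | full => exact Iff.rfl

theorem exists_of_typeSet_eq {ι : Type} {v v' : ι → Set ℕ} (h : typeSet v = typeSet v') (n : ℕ) :
    ∃ n', ∀ i, n ∈ v i ↔ n' ∈ v' i := by
  have h1 : {i | n ∈ v i} ∈ typeSet v' := by rw [← h]; exact ⟨n, rfl⟩
  obtain ⟨n', hn'⟩ := h1
  exact ⟨n', fun i => (Set.ext_iff.1 hn' i).symm⟩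

/-- An equation between terms is checked point by point, and every point for `v` has a counterpart
of the same type for `v'`. -/
theorem realize_eq_of_typeSet_eq {ι : Type} {t₁ t₂ : setLanguage.Term ι} {v v' : ι → Set ℕ}
    (h : typeSet v = typeSet v') (he : t₁.realize v' = t₂.realize v') :
    t₁.realize v = t₂.realize v := by
  ext n
  obtain ⟨n', hn'⟩ := exists_of_typeSet_eq h n
  rw [mem_realize_iff t₁ hn', mem_realize_iff t₂ hn', he]

theorem typeSet_sumElim {k m : ℕ} {v v' : Fin k → Set ℕ} (xs : Fin m → Set ℕ) (hm : m = 0)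
    (h : typeSet v = typeSet v') : typeSet (Sum.elim v xs) = typeSet (Sum.elim v' xs) := by
  subst hm
  have key : ∀ w w' : Fin k → Set ℕ, typeSet w = typeSet w' →
      typeSet (Sum.elim w xs) ⊆ typeSet (Sum.elim w' xs) := by
    rintro w w' hw β ⟨n, rfl⟩
    obtain ⟨n', hn'⟩ := exists_of_typeSet_eq hw n
    refine ⟨n', ?_⟩
    ext i
    rcases i with i | i
    · exact (hn' i).symm
    · exact i.elim0
  exact Set.Subset.antisymm (key v v' h) (key v' v h.symm)

theorem realize_iff_of_typeSet_eq {k m : ℕ} {φ : setLanguage.BoundedFormula (Fin k) m}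
    (hφ : φ.IsQF) (hm : m = 0) {v v' : Fin k → Set ℕ} (h : typeSet v = typeSet v')
    (xs : Fin m → Set ℕ) : φ.Realize v xs ↔ φ.Realize v' xs := by
  induction hφ with
  | falsum => exact Iff.rfl
  | of_isAtomic ha =>
    cases ha with
    | equal t₁ t₂ =>
      exact ⟨realize_eq_of_typeSet_eq (typeSet_sumElim xs hm h).symm,
        realize_eq_of_typeSet_eq (typeSet_sumElim xs hm h)⟩
    | rel R ts => exact R.elim
  | imp _ _ ih₁ ih₂ =>
    exact imp_congr ih₁ ih₂

/-- The type sets of the tuples of a relation. -/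
def typeFamily {k : ℕ} (R : Set (Fin k → Set ℕ)) : Set (Set (Set (Fin k))) := typeSet '' R

theorem mem_iff_typeSet_mem {k : ℕ} {R : Set (Fin k → Set ℕ)} (hR : QFDefinable R)
    (v : Fin k → Set ℕ) : v ∈ R ↔ typeSet v ∈ typeFamily R := by
  refine ⟨fun h => ⟨v, h, rfl⟩, ?_⟩
  rintro ⟨v', hv', he⟩
  obtain ⟨φ, hφ, hR⟩ := hR
  rw [hR] at hv' ⊢
  exact (realize_iff_of_typeSet_eq hφ rfl he _).1 hv'

theorem meetClosure_union_mem {k : ℕ} {R : Set (Fin k → Set ℕ)} {G : ℕ ≃ FinNonempty}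
    (hR : Preserves (eiOp G) R) {A B : Set (Set (Fin k))} (hA : A ∈ typeFamily R)
    (hB : B ∈ typeFamily R) : meetClosure (A ∪ B) ∈ typeFamily R := by
  obtain ⟨a, ha, rfl⟩ := hA
  obtain ⟨b, hb, rfl⟩ := hB
  refine ⟨_, hR ![a, b] ?_, typeSet_eiOp G ![a, b]⟩
  intro i
  fin_cases i
  · exact ha
  · exact hb

/-- If `A` is a non-empty union of members of the family, then its meet closure is a member. -/
theorem meetClosure_mem_of_forall {ι : Type} [Finite ι] {F : Set (Set (Set ι))}
    (hF : ∀ A ∈ F, ∀ B ∈ F, meetClosure (A ∪ B) ∈ F) {A : Set (Set ι)} (hne : A.Nonempty)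
    (hA : ∀ γ ∈ A, ∃ A' ∈ F, A' ⊆ A ∧ γ ∈ A') : meetClosure A ∈ F := by
  obtain ⟨γ, hγ⟩ := hne
  obtain ⟨A₀, hA₀, hsub₀, -⟩ := hA γ hγ
  -- A maximal member of `F` below the meet closure of `A` absorbs every other such member, because
  -- joining the two gives again a member below it. Hence it contains all of `A`.
  obtain ⟨X, hX⟩ := (Set.toFinite {A' ∈ F | A' ⊆ meetClosure A}).exists_maximal
    ⟨A₀, hA₀, hsub₀.trans (subset_meetClosure A)⟩
  have habs : ∀ A' ∈ F, A' ⊆ meetClosure A → meetClosure (X ∪ A') ⊆ X := by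
    intro A' h1 h2
    refine hX.2 ⟨hF X hX.1.1 A' h1, ?_⟩ (Set.subset_union_left.trans (subset_meetClosure _))
    rw [← meetClosure_meetClosure A]
    exact meetClosure_mono (Set.union_subset hX.1.2 h2)
  have hAX : A ⊆ X := by
    intro γ hγ
    obtain ⟨A', h1, h2, h3⟩ := hA γ hγ
    exact habs A' h1 (h2.trans (subset_meetClosure A)) (subset_meetClosure _ (.inr h3))
  have : meetClosure A = X := by
    refine Set.Subset.antisymm ((meetClosure_mono (hAX.trans Set.subset_union_left)).trans
      (habs X hX.1.1 hX.1.2)) hX.1.2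
  rw [this]
  exact hX.1.1

end SetConstraint

/-! ### Closed sets of atoms -/

namespace WordRAM

theorem flatten_getD {w : ℕ} {Rs : List (List ℕ)} (h : ∀ R ∈ Rs, R.length = w) {r j : ℕ}
    (hr : r < Rs.length) (hj : j < w) :
    Rs.flatten.getD (w * r + j) 0 = Rs[r].getD j 0 := by
  induction Rs generalizing r with
  | nil => simp at hr
  | cons R Rs ih =>
    have hR := h R (by simp)
    rw [List.flatten_cons]
    rcases r with _ | r
    · rw [mul_zero, zero_add, List.getD_append _ _ _ _ (by omega)]
      rfl
    · rw [show w * (r + 1) + j = w + (w * r + j) by ring,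
        List.getD_append_right _ _ _ _ (by omega), hR, Nat.add_sub_cancel_left,
        ih (fun R hR => h R (List.mem_cons_of_mem _ hR)) (by simpa using hr)]
      rfl

theorem length_flatten_eq {w : ℕ} {Rs : List (List ℕ)} (h : ∀ R ∈ Rs, R.length = w) :
    Rs.flatten.length = w * Rs.length := by
  induction Rs with
  | nil => simp
  | cons R Rs ih =>
    rw [List.flatten_cons, List.length_append, h R (by simp),
      ih fun R hR => h R (List.mem_cons_of_mem _ hR), List.length_cons]
    ring

theorem ruleClosed_flatten {W : ℕ} {Rs : List (List ℕ)} (h : ∀ R ∈ Rs, R.length = W + 1)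
    (J : Set ℕ) : RuleClosed W Rs.flatten J ↔
      0 ∈ J ∧ ∀ R ∈ Rs, (∀ j < W, R.getD j 0 ∈ J) → R.getD W 0 ∈ J := by
  have hlt : ∀ r, (W + 1) * (r + 1) ≤ Rs.flatten.length ↔ r < Rs.length := by
    intro r
    rw [length_flatten_eq h]
    exact ⟨fun h => Nat.le_of_mul_le_mul_left h (by omega), fun h => Nat.mul_le_mul_left _ h⟩
  refine and_congr_right fun _ => ⟨fun hJ R hR hb => ?_, fun hJ r hr hb => ?_⟩
  · obtain ⟨r, hr, rfl⟩ := List.getElem_of_mem hR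
    rw [← flatten_getD h hr (by omega)]
    refine hJ r ((hlt r).2 hr) fun j hj => ?_
    rw [flatten_getD h hr (by omega)]
    exact hb j hj
  · have hr' := (hlt r).1 hr
    rw [flatten_getD h hr' (by omega)]
    refine hJ _ (List.getElem_mem hr') fun j hj => ?_
    rw [← flatten_getD h hr' (by omega)]
    exact hb j hj

theorem rulesUpTo_eq_flatten (P : Params) (tpl : ℕ → List (List AtomExpr)) (sym : ℕ → ℕ)
    (arg : ℕ → ℕ → ℕ) (D : ℕ) : rulesUpTo P tpl sym arg D 0 =
      ((List.range D).flatMap fun d => (List.range (P.M * P.N)).flatMap fun p =>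
        (tpl (sym d)).map (List.map (AtomExpr.val P.nv P.N d p (arg d)))).flatten := by
  have key : ∀ {α : Type} (l : List α) (f : α → List (List ℕ)),
      (l.flatMap f).flatten = l.flatMap fun a => (f a).flatten := by
    intro α l f
    induction l with
    | nil => rfl
    | cons a l ih => simp only [List.flatMap_cons, List.flatten_append, ih]
  simp only [rulesUpTo, key, List.range_zero, List.flatMap_nil, List.append_nil]
  rfl

/-- A rule with the body padded to `W` atoms, followed by its head. -/
def padRule (W : ℕ) (x : List AtomExpr × AtomExpr) : List AtomExpr :=
  (x.1 ++ List.replicate (W - x.1.length) .tt) ++ [x.2]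

theorem length_padRule {W : ℕ} {x : List AtomExpr × AtomExpr} (h : x.1.length ≤ W) :
    (padRule W x).length = W + 1 := by
  simp [padRule]; omega

theorem mem_padRule {W : ℕ} {x : List AtomExpr × AtomExpr} {e : AtomExpr} (h : e ∈ padRule W x) :
    e = .tt ∨ e ∈ x.1 ∨ e = x.2 := by
  simp only [padRule, List.mem_append, List.mem_replicate, List.mem_singleton] at h
  tauto

/-- The padding atoms have number `0`, which lies in `J`, so they add no condition to the body. -/
theorem padRule_closed_iff {W : ℕ} {x : List AtomExpr × AtomExpr} (h : x.1.length ≤ W)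
    {f : AtomExpr → ℕ} (hf : f .tt = 0) {J : Set ℕ} (h0 : 0 ∈ J) :
    ((∀ j < W, ((padRule W x).map f).getD j 0 ∈ J) → ((padRule W x).map f).getD W 0 ∈ J) ↔
      ((∀ e ∈ x.1, f e ∈ J) → f x.2 ∈ J) := by
  set l := x.1 ++ List.replicate (W - x.1.length) AtomExpr.tt with hl
  have hlen : (l.map f).length = W := by simp [hl]; omega
  have hpad : (padRule W x).map f = l.map f ++ [f x.2] := by
    rw [padRule, ← hl, List.map_append, List.map_singleton]
  have h1 : (l.map f ++ [f x.2]).getD W 0 = f x.2 := by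
    rw [List.getD_append_right _ _ _ _ hlen.le, hlen, Nat.sub_self]; rfl
  have h2 : (∀ j < W, (l.map f ++ [f x.2]).getD j 0 ∈ J) ↔ ∀ e ∈ x.1, f e ∈ J := by
    constructor
    · intro hj e he
      have : f e ∈ l.map f := List.mem_map_of_mem (by rw [hl]; exact List.mem_append_left _ he)
      obtain ⟨j, hj', hje⟩ := List.getElem_of_mem this
      have := hj j (by omega)
      rwa [List.getD_append _ _ _ _ hj', List.getD_eq_getElem _ _ hj', hje] at this
    · intro he j hj
      rw [← hlen] at hj
      rw [List.getD_append _ _ _ _ hj, List.getD_eq_getElem _ _ hj]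
      obtain ⟨e, he', hee⟩ := List.mem_map.1 (List.getElem_mem hj)
      rw [← hee]
      rcases List.mem_append.1 he' with h3 | h3
      · exact he e h3
      · rw [List.eq_of_mem_replicate h3, hf]
        exact h0
  rw [hpad, h1, h2]

end WordRAM

/-! ### The Horn formula of an instance -/

namespace SetConstraint

open WordRAM

/-- The elements of a subset of a finite type. -/
noncomputable def elems {α : Type} [Finite α] (s : Set α) : List α := s.toFinite.toFinset.toList

@[simp] theorem mem_elems {α : Type} [Finite α] {s : Set α} {a : α} : a ∈ elems s ↔ a ∈ s := by
  simp [elems]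

/-- The number of a set of coordinates. -/
noncomputable def code {k : ℕ} (α : Set (Fin k)) : ℕ := Finite.equivFin (Set (Fin k)) α

theorem code_injective {k : ℕ} : Function.Injective (code (k := k)) :=
  fun _ _ h => (Finite.equivFin _).injective (Fin.ext h)

theorem code_lt {k : ℕ} (α : Set (Fin k)) : code α < 2 ^ k := by
  have h : Nat.card (Set (Fin k)) = 2 ^ k := by simp
  rw [← h]
  exact Fin.is_lt _

/-- The atoms saying that the sets in `B` are excluded for the current constraint. -/
noncomputable def removedAtoms {k : ℕ} (B : Set (Set (Fin k))) : List AtomExpr :=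
  (elems B).map fun β => .cell (some (code β)) none

/-- The atoms saying that the current row contains the arguments with numbers in `α`. -/
noncomputable def rowAtoms {k : ℕ} (α : Set (Fin k)) : List AtomExpr :=
  (elems α).map fun i : Fin k => .cell none (some (i : ℕ))

/-- The rules for a constraint whose relation has the type family `F`. The row of the constraint
with number `code α` describes the least element above `α` of the solution; its last atom says that
`α` is excluded. -/
inductive SetRule {k : ℕ} (F : Set (Set (Set (Fin k)))) : List AtomExpr → AtomExpr → Prop
  | start (α : Set (Fin k)) (i : Fin k) (h : i ∈ α) :
      SetRule F [] (.cell (some (code α)) (some i))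
  | exclude (α : Set (Fin k)) (i : Fin k) (h : i ∉ α) :
      SetRule F [.cell (some (code α)) (some i)] (.cell (some (code α)) none)
  | propagate (B : Set (Set (Fin k))) (α : Set (Fin k)) (j : Fin k)
      (h : ∀ β ∉ B, α ⊆ β → j ∈ β) :
      SetRule F (removedAtoms B ++ rowAtoms α) (.cell none (some j))
  | conflict (B : Set (Set (Fin k))) (α : Set (Fin k)) (h : ∀ β ∉ B, ¬ α ⊆ β) :
      SetRule F (removedAtoms B ++ rowAtoms α) (.cell none none)
  | support (B : Set (Set (Fin k))) (γ : Set (Fin k)) (h : ∀ A ∈ F, Disjoint A B → γ ∉ A) :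
      SetRule F (removedAtoms B) (.cell (some (code γ)) none)
  | goal : SetRule F (removedAtoms (Set.univ : Set (Set (Fin k)))) .fail

/-- The parameters of each kind of rule range over finite types, so a relation has finitely many
templates. -/
theorem finite_setRule {k : ℕ} (F : Set (Set (Set (Fin k)))) :
    {x : List AtomExpr × AtomExpr | SetRule F x.1 x.2}.Finite := by
  refine Set.Finite.subset
    ((Set.finite_range fun q : Set (Fin k) × Fin k =>
        (([], .cell (some (code q.1)) (some q.2)) : List AtomExpr × AtomExpr)).union
      ((Set.finite_range fun q : Set (Fin k) × Fin k =>
        (([.cell (some (code q.1)) (some q.2)], .cell (some (code q.1)) none) :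
          List AtomExpr × AtomExpr)).union
      ((Set.finite_range fun q : Set (Set (Fin k)) × Set (Fin k) × Fin k =>
        ((removedAtoms q.1 ++ rowAtoms q.2.1, .cell none (some q.2.2)) :
          List AtomExpr × AtomExpr)).union
      ((Set.finite_range fun q : Set (Set (Fin k)) × Set (Fin k) =>
        ((removedAtoms q.1 ++ rowAtoms q.2, .cell none none) : List AtomExpr × AtomExpr)).union
      ((Set.finite_range fun q : Set (Set (Fin k)) × Set (Fin k) =>
        ((removedAtoms q.1, .cell (some (code q.2)) none) : List AtomExpr × AtomExpr)).union
      (Set.finite_singleton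
        ((removedAtoms (Set.univ : Set (Set (Fin k))), .fail) : List AtomExpr × AtomExpr))))))) ?_
  rintro ⟨body, head⟩ h
  change SetRule F body head at h
  cases h with
  | start α i h => exact .inl ⟨(α, i), rfl⟩
  | exclude α i h => exact .inr (.inl ⟨(α, i), rfl⟩)
  | propagate B α j h => exact .inr (.inr (.inl ⟨(B, α, j), rfl⟩))
  | conflict B α h => exact .inr (.inr (.inr (.inl ⟨(B, α), rfl⟩)))
  | support B γ h => exact .inr (.inr (.inr (.inr (.inl ⟨(B, γ), rfl⟩))))
  | goal => exact .inr (.inr (.inr (.inr (.inr rfl))))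

theorem setRule_cell {k : ℕ} {F : Set (Set (Set (Fin k)))} {body : List AtomExpr}
    {head : AtomExpr} (h : SetRule F body head) {row col : Option ℕ}
    (hmem : AtomExpr.cell row col ∈ body ∨ AtomExpr.cell row col = head) :
    (∀ c ∈ row, c < 2 ^ k) ∧ ∀ i ∈ col, i < k := by
  have hrow : ∀ (α : Set (Fin k)), ∀ c ∈ some (code α), c < 2 ^ k := by
    rintro α c ⟨⟩
    exact code_lt α
  have hcol : ∀ (i : Fin k), ∀ c ∈ some (i : ℕ), c < k := by
    rintro i c ⟨⟩
    exact i.2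
  have hnone : ∀ m, ∀ c ∈ (none : Option ℕ), c < m := by
    rintro m c ⟨⟩
  have hrem : ∀ B : Set (Set (Fin k)), AtomExpr.cell row col ∈ removedAtoms B →
      (∀ c ∈ row, c < 2 ^ k) ∧ ∀ i ∈ col, i < k := by
    intro B h
    obtain ⟨β, -, h⟩ := List.mem_map.1 h
    cases h
    exact ⟨hrow β, hnone k⟩
  have happ : ∀ (B : Set (Set (Fin k))) (α : Set (Fin k)),
      AtomExpr.cell row col ∈ removedAtoms B ++ rowAtoms α →
      (∀ c ∈ row, c < 2 ^ k) ∧ ∀ i ∈ col, i < k := by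
    intro B α h
    rcases List.mem_append.1 h with h | h
    · exact hrem B h
    · obtain ⟨i, -, h⟩ := List.mem_map.1 h
      cases h
      exact ⟨hnone _, hcol _⟩
  cases h with
  | start α i h =>
    rcases hmem with hmem | hmem
    · cases hmem
    · cases hmem; exact ⟨hrow α, hcol _⟩
  | exclude α i h =>
    rcases hmem with hmem | hmem
    · cases List.mem_singleton.1 hmem; exact ⟨hrow α, hcol _⟩
    · cases hmem; exact ⟨hrow α, hnone _⟩
  | propagate B α j h =>
    rcases hmem with hmem | hmem
    · exact happ B α hmem
    · cases hmem; exact ⟨hnone _, hcol _⟩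
  | conflict B α h =>
    rcases hmem with hmem | hmem
    · exact happ B α hmem
    · cases hmem; exact ⟨hnone _, hnone _⟩
  | support B γ h =>
    rcases hmem with hmem | hmem
    · exact hrem B hmem
    · cases hmem; exact ⟨hrow γ, hnone _⟩
  | goal =>
    rcases hmem with hmem | hmem
    · exact hrem _ hmem
    · cases hmem

/-- The arguments of a constraint as numbers. -/
def argNum {nv k : ℕ} (x : Fin k → Fin nv) (i : ℕ) : ℕ :=
  (List.ofFn fun j => (x j : ℕ)).getD i 0

@[simp] theorem argNum_fin {nv k : ℕ} (x : Fin k → Fin nv) (i : Fin k) : argNum x i = x i := by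
  simp [argNum]

end SetConstraint

/-! ### Soundness and completeness of the Horn formula -/

namespace SetConstraint

open WordRAM

variable {Γ : ConstraintLanguage (Set ℕ)}

/-- The set `J` of atoms is closed under the rules for the constraints of the instance. -/
def InstClosed (I : Γ.CSPInstance) (N : ℕ) (J : Set ℕ) : Prop :=
  0 ∈ J ∧ ∀ (D : ℕ) (hD : D < I.constraints.length), ∀ p < I.constraints.length * N,
    ∀ body head, SetRule (typeFamily (Γ.rel I.constraints[D].1)) body head →
      (∀ e ∈ body, e.val I.numVars N D p (argNum I.constraints[D].2) ∈ J) →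
      head.val I.numVars N D p (argNum I.constraints[D].2) ∈ J

/-- The arguments of a constraint that belong to a given set of variables. -/
def restrict {I : Γ.CSPInstance} (D : ℕ) (hD : D < I.constraints.length)
    (y : Set (Fin I.numVars)) : Set (Fin (Γ.arity I.constraints[D].1)) :=
  {i | I.constraints[D].2 i ∈ y}

theorem typeSet_comp {ι κ : Type} (s : κ → Set ℕ) (x : ι → κ) :
    typeSet (fun j => s (x j)) = (fun y : Set κ => {i | x i ∈ y}) '' typeSet s := by
  rw [typeSet, typeSet, ← Set.range_comp]
  rfl

theorem forall_mem_removedAtoms {k : ℕ} {B : Set (Set (Fin k))} {P : AtomExpr → Prop} :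
    (∀ e ∈ removedAtoms B, P e) ↔ ∀ β ∈ B, P (.cell (some (code β)) none) := by
  simp [removedAtoms]

theorem forall_mem_rowAtoms {k : ℕ} {α : Set (Fin k)} {P : AtomExpr → Prop} :
    (∀ e ∈ rowAtoms α, P e) ↔ ∀ i ∈ α, P (.cell none (some (i : ℕ))) := by
  simp [rowAtoms]

theorem forall_mem_append_atoms {k : ℕ} {B : Set (Set (Fin k))} {α : Set (Fin k)}
    {P : AtomExpr → Prop} : (∀ e ∈ removedAtoms B ++ rowAtoms α, P e) ↔
      (∀ β ∈ B, P (.cell (some (code β)) none)) ∧ ∀ i ∈ α, P (.cell none (some (i : ℕ))) := by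
  rw [List.forall_mem_append, forall_mem_removedAtoms, forall_mem_rowAtoms]

/-- Uniqueness of mixed-radix representations, used with rows and columns for cells, and with
constraints and codes for rows. -/
theorem row_inj {N c c' D D' : ℕ} (hc : c < N) (hc' : c' < N) (h : c + D * N = c' + D' * N) :
    c = c' ∧ D = D' := by
  have h1 : (c + D * N) % N = (c' + D' * N) % N := by rw [h]
  rw [Nat.add_mul_mod_self_right, Nat.add_mul_mod_self_right, Nat.mod_eq_of_lt hc,
    Nat.mod_eq_of_lt hc'] at h1
  refine ⟨h1, Nat.eq_of_mul_eq_mul_right (show 0 < N by omega) (by omega)⟩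

/-- The condition on the solutions `Y` expressed by cell `w` of row `p`. -/
def Meaning (I : Γ.CSPInstance) (N : ℕ) (Y : Set (Set (Fin I.numVars))) (p w : ℕ) : Prop :=
  ∀ (D : ℕ) (hD : D < I.constraints.length) (α : Set (Fin (Γ.arity I.constraints[D].1))),
    p = code α + D * N → (w = I.numVars → ∀ y ∈ Y, restrict D hD y ≠ α) ∧
      ∀ h : w < I.numVars, ∀ y ∈ Y, α ⊆ restrict D hD y → (⟨w, h⟩ : Fin I.numVars) ∈ y

/-- Take for `J` the true atom and all cells whose `Meaning` holds for the type set of a solution.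
The rules are implications valid for this type set, and the failure atom is not a cell, as cells are
numbered from `2`. -/
theorem exists_instClosed {I : Γ.CSPInstance} {N : ℕ} (hN : ∀ r, 2 ^ Γ.arity r ≤ N)
    (h : I.Satisfiable) : ∃ J, InstClosed I N J ∧ 1 ∉ J := by
  obtain ⟨s, hs⟩ := h
  set Y := typeSet s with hY
  obtain ⟨y₀, hy₀⟩ : Y.Nonempty := ⟨_, 0, rfl⟩
  set J : Set ℕ := {x | x = 0 ∨ ∃ p w, w ≤ I.numVars ∧ x = 2 + p * (I.numVars + 1) + w ∧
    Meaning I N Y p w} with hJ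
  have hcell : ∀ p w, w ≤ I.numVars → (2 + p * (I.numVars + 1) + w ∈ J ↔ Meaning I N Y p w) := by
    intro p w hw
    constructor
    · rintro (h | ⟨p', w', hw', h, hm⟩)
      · omega
      · obtain ⟨rfl, rfl⟩ := row_inj (N := I.numVars + 1) (c := w) (c' := w') (D := p) (D' := p')
          (by omega) (by omega) (by omega)
        exact hm
    · exact fun hm => .inr ⟨p, w, hw, rfl, hm⟩
  have hcode : ∀ (D : ℕ) (hD : D < I.constraints.length)
      (α : Set (Fin (Γ.arity I.constraints[D].1))), code α < N :=
    fun D hD α => (code_lt α).trans_le (hN _)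
  -- Since codes are below `N`, a row number determines its constraint and its set, so the
  -- quantifiers in `Meaning` reduce to a single case.
  have huniq : ∀ (D : ℕ) (hD : D < I.constraints.length)
      (α : Set (Fin (Γ.arity I.constraints[D].1))) (w : ℕ),
      Meaning I N Y (code α + D * N) w ↔ (w = I.numVars → ∀ y ∈ Y, restrict D hD y ≠ α) ∧
      ∀ h : w < I.numVars, ∀ y ∈ Y, α ⊆ restrict D hD y → (⟨w, h⟩ : Fin I.numVars) ∈ y := by
    intro D hD α w
    refine ⟨fun h => h D hD α rfl, fun h D' hD' α' he => ?_⟩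
    obtain ⟨h1, rfl⟩ := row_inj (hcode D hD α) (hcode D' hD' α') he
    rw [← code_injective h1]
    exact h
  have hrem : ∀ (D : ℕ) (hD : D < I.constraints.length)
      (β : Set (Fin (Γ.arity I.constraints[D].1))) (p : ℕ) (arg : ℕ → ℕ),
      AtomExpr.val I.numVars N D p arg (.cell (some (code β)) none) ∈ J ↔
        ∀ y ∈ Y, restrict D hD y ≠ β := by
    intro D hD β p arg
    refine (hcell _ _ le_rfl).trans ((huniq D hD β _).trans ?_)
    simp
  have hself : ∀ (D : ℕ) (hD : D < I.constraints.length)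
      (β : Set (Fin (Γ.arity I.constraints[D].1))) (i : Fin (Γ.arity I.constraints[D].1)) (p : ℕ),
      AtomExpr.val I.numVars N D p (argNum I.constraints[D].2)
        (.cell (some (code β)) (some (i : ℕ))) ∈ J ↔
        ∀ y ∈ Y, β ⊆ restrict D hD y → i ∈ restrict D hD y := by
    intro D hD β i p
    have hlt := (I.constraints[D].2 i).2
    simp only [AtomExpr.val, Option.elim, argNum_fin]
    refine (hcell _ _ hlt.le).trans ((huniq D hD β _).trans ?_)
    constructor
    · exact fun h => h.2 hlt
    · exact fun h => ⟨fun he => absurd he hlt.ne, fun _ => h⟩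
  have hrow : ∀ (D : ℕ) (hD : D < I.constraints.length)
      (i : Fin (Γ.arity I.constraints[D].1)) (p : ℕ),
      AtomExpr.val I.numVars N D p (argNum I.constraints[D].2) (.cell none (some (i : ℕ))) ∈ J ↔
        ∀ (D' : ℕ) (hD' : D' < I.constraints.length) (α : Set (Fin (Γ.arity I.constraints[D'].1))),
          p = code α + D' * N → ∀ y ∈ Y, α ⊆ restrict D' hD' y → i ∈ restrict D hD y := by
    intro D hD i p
    have hlt := (I.constraints[D].2 i).2
    simp only [AtomExpr.val, Option.elim, argNum_fin]
    refine (hcell _ _ hlt.le).trans ?_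
    constructor
    · exact fun h D' hD' α he => (h D' hD' α he).2 hlt
    · exact fun h D' hD' α he => ⟨fun he => absurd he hlt.ne, fun _ => h D' hD' α he⟩
  have hlast : ∀ (D p : ℕ) (arg : ℕ → ℕ), AtomExpr.val I.numVars N D p arg (.cell none none) ∈ J ↔
        ∀ (D' : ℕ) (hD' : D' < I.constraints.length) (α : Set (Fin (Γ.arity I.constraints[D'].1))),
          p = code α + D' * N → ∀ y ∈ Y, restrict D' hD' y ≠ α := by
    intro D p arg
    refine (hcell _ _ le_rfl).trans ?_
    simp [Meaning]
  refine ⟨J, ⟨.inl rfl, ?_⟩, ?_⟩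
  · intro D hD p hp body head hrule hbody
    cases hrule with
    | start α i hi =>
      rw [hself D hD]
      exact fun y _ h => h hi
    | exclude α i hi =>
      rw [List.forall_mem_singleton, hself D hD] at hbody
      rw [hrem D hD]
      intro y hy he
      have := hbody y hy he.ge
      rw [he] at this
      exact hi this
    | propagate B α j hj =>
      rw [forall_mem_append_atoms] at hbody
      rw [hrow D hD]
      intro D' hD' α' he y hy hsub
      -- The restriction of `y` to constraint `D` is not excluded, and it contains `α` because row
      -- `p` forces these variables into `y`.
      refine hj (restrict D hD y) (fun hB => ?_) (fun i hi => ?_)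
      · exact (hrem D hD _ _ _).1 (hbody.1 _ hB) y hy rfl
      · exact (hrow D hD i p).1 (hbody.2 i hi) D' hD' α' he y hy hsub
    | conflict B α hj =>
      rw [forall_mem_append_atoms] at hbody
      rw [hlast]
      intro D' hD' α' he y hy heq
      refine hj (restrict D hD y) (fun hB => ?_) (fun i hi => ?_)
      · exact (hrem D hD _ _ _).1 (hbody.1 _ hB) y hy rfl
      · exact (hrow D hD i p).1 (hbody.2 i hi) D' hD' α' he y hy heq.ge
    | support B γ hγ =>
      rw [forall_mem_removedAtoms] at hbody
      rw [hrem D hD]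
      intro y hy he
      -- The type set of the constrained tuple is a member of the family which avoids the excluded
      -- sets and contains `γ`.
      refine hγ (restrict D hD '' Y) ?_ ?_ ⟨y, hy, he⟩
      · exact ⟨_, hs _ (List.getElem_mem hD), typeSet_comp s _⟩
      · rw [Set.disjoint_left]
        rintro _ ⟨y, hy, rfl⟩ hB
        exact (hrem D hD _ _ _).1 (hbody _ hB) y hy rfl
    | goal =>
      rw [forall_mem_removedAtoms] at hbody
      -- A type set is never empty, as ℕ is not, so not all sets can be excluded.
      exact absurd rfl ((hrem D hD _ _ _).1 (hbody (restrict D hD y₀) trivial) y₀ hy₀)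
  · rintro (h | ⟨p, w, -, h, -⟩) <;> omega

theorem restrict_sInter {I : Γ.CSPInstance} (D : ℕ) (hD : D < I.constraints.length)
    (T : Set (Set (Fin I.numVars))) : restrict D hD (⋂₀ T) = ⋂₀ (restrict D hD '' T) := by
  ext i
  simp [restrict]

/-- For each surviving `α` the atoms in `J` describe a least candidate `m D hD α`. The meet closure
of all candidates has, on every constraint, exactly the meet closure of the surviving sets as its
restrictions, and the `support` rules place that closure in the type family. -/
theorem satisfiable_of_instClosed {I : Γ.CSPInstance} {N : ℕ} (hN : ∀ r, 2 ^ Γ.arity r ≤ N)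
    (hQF : ∀ r, QFDefinable (Γ.rel r))
    (hmeet : ∀ r, ∀ A ∈ typeFamily (Γ.rel r), ∀ B ∈ typeFamily (Γ.rel r),
      meetClosure (A ∪ B) ∈ typeFamily (Γ.rel r)) {J : Set ℕ} (h : InstClosed I N J)
    (h1 : 1 ∉ J) : I.Satisfiable := by
  -- Without constraints there are no candidates, and the family built below would be empty.
  rcases Nat.eq_zero_or_pos I.constraints.length with h0 | h0
  · refine ⟨fun _ => ∅, ?_⟩
    rw [List.eq_nil_of_length_eq_zero h0]
    simp
  have hrow : ∀ (D : ℕ) (hD : D < I.constraints.length)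
      (α : Set (Fin (Γ.arity I.constraints[D].1))), code α + D * N < I.constraints.length * N := by
    intro D hD α
    have h2 := (code_lt α).trans_le (hN _)
    have h3 := Nat.mul_le_mul_right N (show D + 1 ≤ I.constraints.length from hD)
    rw [Nat.add_mul, one_mul] at h3
    omega
  let rem : ∀ (D : ℕ) (hD : D < I.constraints.length),
      Set (Set (Fin (Γ.arity I.constraints[D].1))) :=
    fun D hD => {α | 2 + (code α + D * N) * (I.numVars + 1) + I.numVars ∈ J}
  let m : ∀ (D : ℕ) (hD : D < I.constraints.length),
      Set (Fin (Γ.arity I.constraints[D].1)) → Set (Fin I.numVars) :=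
    fun D hD α => {v | 2 + (code α + D * N) * (I.numVars + 1) + (v : ℕ) ∈ J}
  have hremAtoms : ∀ (D : ℕ) (hD : D < I.constraints.length) (p : ℕ), ∀ β ∈ rem D hD,
      (AtomExpr.cell (some (code β)) none).val I.numVars N D p (argNum I.constraints[D].2) ∈ J :=
    fun D hD p β hβ => hβ
  have hne : ∀ (D : ℕ) (hD : D < I.constraints.length), ((rem D hD)ᶜ).Nonempty := by
    intro D hD
    rw [Set.nonempty_compl]
    intro hall
    -- Rules that do not mention the current row are repeated for every row, so any valid row will
    -- do; the row of `∅` is an arbitrary choice here and in later uses.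
    refine h1 (h.2 D hD _ (hrow D hD ∅) _ _ .goal ?_)
    rw [forall_mem_removedAtoms]
    exact fun β _ => hremAtoms D hD _ β (by rw [hall]; trivial)
  have hm : ∀ (D : ℕ) (hD : D < I.constraints.length), ∀ α ∉ rem D hD,
      restrict D hD (m D hD α) = α := by
    intro D hD α hα
    ext i
    constructor
    · intro hi
      by_contra hiα
      refine hα (h.2 D hD _ (hrow D hD ∅) _ _ (.exclude α i hiα) ?_)
      rw [List.forall_mem_singleton]
      simp only [AtomExpr.val, Option.elim, argNum_fin]
      exact hi
    · intro hi
      have := h.2 D hD _ (hrow D hD ∅) _ _ (.start α i hi) (by simp)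
      simp only [AtomExpr.val, Option.elim, argNum_fin] at this
      exact this
  -- On another constraint, the candidate restricts to the intersection of all surviving sets above
  -- this restriction: by `propagate` it contains the intersection, and by `conflict` there is at
  -- least one such set, since otherwise `α` would be excluded.
  have hmem : ∀ (D : ℕ) (hD : D < I.constraints.length), ∀ α ∉ rem D hD,
      ∀ (D' : ℕ) (hD' : D' < I.constraints.length),
      restrict D' hD' (m D hD α) ∈ meetClosure (rem D' hD')ᶜ := by
    intro D hD α hα D' hD'
    have hbody : ∀ e ∈ removedAtoms (rem D' hD') ++ rowAtoms (restrict D' hD' (m D hD α)),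
        e.val I.numVars N D' (code α + D * N) (argNum I.constraints[D'].2) ∈ J := by
      rw [forall_mem_append_atoms]
      refine ⟨hremAtoms D' hD' _, fun i hi => ?_⟩
      simp only [AtomExpr.val, Option.elim, argNum_fin]
      exact hi
    refine ⟨{β | β ∉ rem D' hD' ∧ restrict D' hD' (m D hD α) ⊆ β}, fun β hβ => hβ.1, ?_, ?_⟩
    · by_contra hemp
      rw [Set.not_nonempty_iff_eq_empty] at hemp
      refine hα (h.2 D' hD' _ (hrow D hD α) _ _ (.conflict _ _ fun β hβ hsub => ?_) hbody)
      have : β ∈ (∅ : Set (Set (Fin (Γ.arity I.constraints[D'].1)))) := by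
        rw [← hemp]; exact ⟨hβ, hsub⟩
      exact this
    · refine Set.Subset.antisymm (fun i hi β hβ => hβ.2 hi) fun j hj => ?_
      have := h.2 D' hD' _ (hrow D hD α) _ _
        (.propagate _ _ j fun β hβ hsub => hj β ⟨hβ, hsub⟩) hbody
      simp only [AtomExpr.val, Option.elim, argNum_fin] at this
      exact this
  set X₀ : Set (Set (Fin I.numVars)) :=
    {x | ∃ (D : ℕ) (hD : D < I.constraints.length), ∃ α ∉ rem D hD, x = m D hD α} with hX₀
  have himage : ∀ (D : ℕ) (hD : D < I.constraints.length),
      restrict D hD '' meetClosure X₀ = meetClosure (rem D hD)ᶜ := by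
    intro D hD
    ext β
    constructor
    · rintro ⟨_, ⟨T, hT, hTne, rfl⟩, rfl⟩
      rw [restrict_sInter]
      refine sInter_mem_meetClosure ?_ (hTne.image _)
      rintro _ ⟨x, hx, rfl⟩
      obtain ⟨D', hD', α, hα, rfl⟩ := hT hx
      exact hmem D' hD' α hα D hD
    · rintro ⟨T, hT, hTne, rfl⟩
      refine ⟨⋂₀ (m D hD '' T), ⟨_, ?_, hTne.image _, rfl⟩, ?_⟩
      · rintro _ ⟨α, hα, rfl⟩
        exact ⟨D, hD, α, hT hα, rfl⟩
      · rw [restrict_sInter, Set.image_image, Set.image_congr fun α hα => hm D hD α (hT hα),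
          Set.image_id']
  have hfam : ∀ (D : ℕ) (hD : D < I.constraints.length),
      meetClosure (rem D hD)ᶜ ∈ typeFamily (Γ.rel I.constraints[D].1) := by
    intro D hD
    refine meetClosure_mem_of_forall (hmeet _) (hne D hD) fun γ hγ => ?_
    by_contra hno
    refine hγ (h.2 D hD _ (hrow D hD ∅) _ _ (.support (rem D hD) γ fun A hA hdis hγA => ?_) ?_)
    · exact hno ⟨A, hA, hdis.subset_compl_right, hγA⟩
    · rw [forall_mem_removedAtoms]
      exact hremAtoms D hD _
  have hXne : (meetClosure X₀).Nonempty := by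
    obtain ⟨α, hα⟩ := hne 0 h0
    exact ⟨_, subset_meetClosure _ ⟨0, h0, α, hα, rfl⟩⟩
  -- The family of sets of variables is listed along ℕ; giving point `n` the type `f n` turns it
  -- into an assignment.
  obtain ⟨f, hf⟩ := (Set.to_countable (meetClosure X₀)).exists_eq_range hXne
  refine ⟨fun v => {n | v ∈ f n}, fun C hC => ?_⟩
  obtain ⟨D, hD, rfl⟩ := List.getElem_of_mem hC
  have htype : typeSet (fun v => {n | v ∈ f n}) = meetClosure X₀ := by
    rw [hf]
    rfl
  rw [mem_iff_typeSet_mem (hQF _), typeSet_comp (fun v => {n | v ∈ f n}), htype]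
  have := hfam D hD
  rw [← himage D hD] at this
  exact this

end SetConstraint

/-! ### Translating instances into rule lists, and the main theorem -/

namespace SetConstraint

open WordRAM

/-- The rule templates for the relation with number `r`. -/
noncomputable def templates (Γ : ConstraintLanguage (Set ℕ)) (W r : ℕ) : List (List AtomExpr) :=
  if h : r < Γ.numRels then
    (finite_setRule (typeFamily (Γ.rel ⟨r, h⟩))).toFinset.toList.map (padRule W) else []

/-- The arity of the relation with number `r`. -/
def arityNum (Γ : ConstraintLanguage (Set ℕ)) (r : ℕ) : ℕ :=
  if h : r < Γ.numRels then Γ.arity ⟨r, h⟩ else 0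

theorem mem_templates {Γ : ConstraintLanguage (Set ℕ)} {W : ℕ} (r : Fin Γ.numRels)
    {b : List AtomExpr} : b ∈ templates Γ W r ↔
      ∃ body head, SetRule (typeFamily (Γ.rel r)) body head ∧ padRule W (body, head) = b := by
  simp [templates]

variable {Γ : ConstraintLanguage (Set ℕ)}

/-- The constraints of an instance in terms of numbers. -/
def constraintsNum (I : Γ.CSPInstance) : List (ℕ × List ℕ) :=
  I.constraints.map fun C => ((C.1 : ℕ), List.ofFn fun j => (C.2 j : ℕ))

theorem inputOf_constraintsNum (I : Γ.CSPInstance) :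
    inputOf I.numVars (constraintsNum I) = I.encode := by
  simp [inputOf, constraintsNum, ConstraintLanguage.CSPInstance.encode, List.flatMap_map]

/-- The added `1` makes `W` positive, so that empty bodies are padded with a true atom as the solver
requires. -/
theorem exists_body_bound (Γ : ConstraintLanguage (Set ℕ)) :
    ∃ W, 0 < W ∧ ∀ (r : Fin Γ.numRels) body head, SetRule (typeFamily (Γ.rel r)) body head →
      body.length ≤ W := by
  refine ⟨(Finset.univ.sup fun r : Fin Γ.numRels =>
    (finite_setRule (typeFamily (Γ.rel r))).toFinset.sup fun x => x.1.length) + 1,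
    by omega, fun r body head h => ?_⟩
  have h1 : body.length ≤ (finite_setRule (typeFamily (Γ.rel r))).toFinset.sup
      fun x => x.1.length :=
    Finset.le_sup (f := fun x : List AtomExpr × AtomExpr => x.1.length) (b := (body, head))
      (by simpa using h)
  have h2 := Finset.le_sup (f := fun r : Fin Γ.numRels =>
    (finite_setRule (typeFamily (Γ.rel r))).toFinset.sup fun x => x.1.length) (Finset.mem_univ r)
  exact (h1.trans h2).trans (Nat.le_succ _)

theorem templates_spec {N W : ℕ} (hN : ∀ r, 2 ^ Γ.arity r ≤ N)
    (hW : ∀ (r : Fin Γ.numRels) body head, SetRule (typeFamily (Γ.rel r)) body head →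
      body.length ≤ W) : Templates Γ.numRels (arityNum Γ) N W (templates Γ W) := by
  have hcell : ∀ r (hr : r < Γ.numRels), ∀ b ∈ templates Γ W r, ∀ row col,
      AtomExpr.cell row col ∈ b → (∀ c ∈ row, c < 2 ^ Γ.arity ⟨r, hr⟩) ∧
        ∀ i ∈ col, i < Γ.arity ⟨r, hr⟩ := by
    intro r hr b hb row col hmem
    obtain ⟨body, head, hrule, rfl⟩ := (mem_templates ⟨r, hr⟩).1 hb
    refine setRule_cell hrule ?_
    rcases mem_padRule hmem with h | h
    · cases h
    · exact h
  refine ⟨fun r hr b hb => ?_, fun r hr b hb row col hmem c hc => ?_,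
    fun r hr b hb row col hmem i hi => ?_⟩
  · obtain ⟨body, head, hrule, rfl⟩ := (mem_templates ⟨r, hr⟩).1 hb
    exact length_padRule (hW _ _ _ hrule)
  · exact ((hcell r hr b hb row col hmem).1 c hc).trans_le (hN _)
  · rw [arityNum, dif_pos hr]
    exact (hcell r hr b hb row col hmem).2 i hi

theorem symOf_constraintsNum (I : Γ.CSPInstance) {D : ℕ} (hD : D < I.constraints.length) :
    symOf (constraintsNum I) D = I.constraints[D].1 := by
  simp [symOf, constraintsNum, hD]

theorem argOf_constraintsNum (I : Γ.CSPInstance) {D : ℕ} (hD : D < I.constraints.length) :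
    argOf (constraintsNum I) D = argNum I.constraints[D].2 := by
  funext i
  simp [argOf, constraintsNum, hD, argNum]

theorem ruleClosed_iff_instClosed {N W : ℕ} (hN : ∀ r, 2 ^ Γ.arity r ≤ N)
    (hW : ∀ (r : Fin Γ.numRels) body head, SetRule (typeFamily (Γ.rel r)) body head →
      body.length ≤ W) (I : Γ.CSPInstance) (K : ℕ) (J : Set ℕ) :
    RuleClosed W (rulesUpTo (paramsOf N W K I.numVars (constraintsNum I)) (templates Γ W)
      (symOf (constraintsNum I)) (argOf (constraintsNum I)) (constraintsNum I).length 0) J ↔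
    InstClosed I N J := by
  have hlen : (constraintsNum I).length = I.constraints.length := by simp [constraintsNum]
  rw [rulesUpTo_eq_flatten, ruleClosed_flatten]
  · refine and_congr_right fun h0 => ?_
    simp only [List.mem_flatMap, List.mem_range, List.mem_map, hlen]
    change (∀ R, (∃ D < I.constraints.length, ∃ p < (constraintsNum I).length * N, ∃ b ∈ _, _) →
      _) ↔ _
    rw [hlen]
    constructor
    · intro h D hD p hp body head hrule
      rw [← padRule_closed_iff (x := (body, head)) (hW _ _ _ hrule) (f := AtomExpr.val I.numVars N D p
        (argNum I.constraints[D].2)) rfl h0]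
      refine h _ ⟨D, hD, p, hp, padRule W (body, head), ?_, ?_⟩
      · rw [symOf_constraintsNum I hD]
        exact (mem_templates _).2 ⟨body, head, hrule, rfl⟩
      · rw [argOf_constraintsNum I hD]
        rfl
    · rintro h _ ⟨D, hD, p, hp, b, hb, rfl⟩
      rw [symOf_constraintsNum I hD] at hb
      obtain ⟨body, head, hrule, rfl⟩ := (mem_templates _).1 hb
      rw [argOf_constraintsNum I hD]
      exact (padRule_closed_iff (x := (body, head)) (hW _ _ _ hrule) (f := AtomExpr.val I.numVars N D
        p (argNum I.constraints[D].2)) rfl h0).2 (h D hD p hp body head hrule)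
  · intro R hR
    simp only [List.mem_flatMap, List.mem_range, List.mem_map] at hR
    obtain ⟨D, hD, p, -, b, hb, rfl⟩ := hR
    rw [hlen] at hD
    rw [symOf_constraintsNum I hD] at hb
    rw [List.length_map]
    exact (templates_spec hN hW).length_eq _ (Fin.is_lt _) b hb

end SetConstraint

theorem mainTheorem1 (G : ℕ ≃ SetConstraint.FinNonempty) (Γ : ConstraintLanguage (Set ℕ))
    (hΓ : ∀ r : Fin Γ.numRels, Γ.rel r ∈ SetConstraint.EI G (Γ.arity r)) :
    Γ.CSPSolvableInQuadraticTime := by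
  obtain ⟨W, hW0, hW⟩ := SetConstraint.exists_body_bound Γ
  -- Every constraint gets the same number `N` of rows, enough for all subsets of its arguments;
  -- surplus rows encode nothing.
  obtain ⟨N, hN⟩ : ∃ N, ∀ r, 2 ^ Γ.arity r ≤ N :=
    ⟨Finset.univ.sup fun r => 2 ^ Γ.arity r,
      fun r => Finset.le_sup (f := fun r => 2 ^ Γ.arity r) (Finset.mem_univ r)⟩
  obtain ⟨p, c, K, h⟩ := WordRAM.exists_program (SetConstraint.templates_spec hN hW) hW0
  refine ⟨p, c, fun I => ?_⟩
  obtain ⟨t, τ, h1, h2, h3⟩ := h I.numVars (SetConstraint.constraintsNum I) (by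
    intro C hC
    obtain ⟨C, -, rfl⟩ := List.mem_map.1 hC
    refine ⟨C.1.2, by simp [SetConstraint.arityNum], fun x hx => ?_⟩
    obtain ⟨j, rfl⟩ := (List.mem_ofFn' _ _).1 hx
    exact (C.2 j).2)
  rw [SetConstraint.inputOf_constraintsNum] at h1 h2
  refine ⟨t, τ, h1, h2, h3.trans ?_⟩
  simp only [SetConstraint.ruleClosed_iff_instClosed hN hW]
  exact ⟨fun ⟨J, hJ, hJ1⟩ => SetConstraint.satisfiable_of_instClosed hN (fun r => (hΓ r).1)
    (fun r A hA B hB => SetConstraint.meetClosure_union_mem (hΓ r).2 hA hB) hJ hJ1,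
    SetConstraint.exists_instClosed hN⟩
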